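/- Let $\alpha\in(1,2)$, $\beta\in(0,\alpha/2)$, and let $\varepsilon_1,\varepsilon_2>0$, $\kappa,\sigma_\xi,\sigma_\eta\ge 0$. There is a constant $C>0$, depending only on $\alpha,\beta,\varepsilon_1,\varepsilon_2,\kappa,\sigma_\xi,\sigma_\eta$, such that the following holds. Let $(S,\mu)$ be a measure space, let $f,g\in L^\alpha(S,\mu)$ be real-valued, and write $\|h\|_\alpha=(\int_S|h|^\alpha\,d\mu)^{1/\alpha}$. Let $(\xi,\eta)$ be a symmetric $\alpha$-stable random vector with the representation $\xi=\int_S f\,dM$, $\eta=\int_S g\,dM$ in law, where $M$ is a symmetric $\alpha$-stable random measure with control measure $\mu$; that is, $$E\,e^{i(u\xi+v\eta)}=e^{-\|uf+vg\|_\alpha^\alpha}\qquad(u,v\in\mathbb R).$$ Suppose that the scale coefficients $\|\xi\|_\alpha=\|f\|_\alpha$ and $\|\eta\|_\alpha=\|g\|_\alpha$ are $\sigma_\xi$ and $\sigma_\eta$, and that * (A1) $\displaystyle \|f\|_\alpha^{\alpha/2}\|g\|_\alpha^{\alpha/2}-\int_S|fg|^{\alpha/2}\,d\mu\ \ge\ \varepsilon_1\|f\|_\alpha^{\alpha/2}\|g\|_\alpha^{\alpha/2}$;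 * (A2) $\displaystyle \|uf+vg\|_\alpha^\alpha\ \ge\ \varepsilon_2\bigl(\|uf\|_\alpha^\alpha+\|vg\|_\alpha^\alpha\bigr)$ for all $u,v\in\mathbb R$. Let $b\ge1$ and let $K:\mathbb R\to\mathbb R$ satisfy * (K1) $|K(x)|\le\kappa|x|^\beta$ for $|x|>b$; * (K2) $K(x)/x$ is non-increasing on $(b,\infty)$ and monotone (non-decreasing or non-increasing) on $(-\infty,-b)$. Put $K_b(x)=K(x)1_{\{|x|>b\}}$ and let $L\in L^1(\mathbb R)$. Then $K_b(\xi)$, $L(\eta)$ and $K_b(\xi)L(\eta)$ are integrable, so that $\mathrm{Cov}(K_b(\xi),L(\eta))$ is well defined, and $$|\mathrm{Cov}(K_b(\xi),L(\eta))|\ \le\ C\,b^{\beta-1}\log(b+1)\,\|L\|_1\,\bigl([\eta,\xi]_1^*+[\eta,\xi]_2\bigr),$$ where $[\eta,\xi]_1^*=\int_S|g|^{\alpha-1}|f|\,d\mu$ and $[\eta,\xi]_2=\int_S|fg|^{\alpha/2}\,d\mu$. -/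

import Mathlib

open MeasureTheory ProbabilityTheory

/-- `‖f‖_α = (∫_S |f|^α dμ)^{1/α}`. -/
noncomputable def alphaNorm {S : Type*} [MeasurableSpace S] (α : ℝ) (μ : Measure S)
    (f : S → ℝ) : ℝ :=
  (∫ s, |f s| ^ α ∂μ) ^ (1 / α)

/-- The random vector `(ξ, η)` is symmetric `α`-stable with representation
`(ξ, η) = (∫ f dM, ∫ g dM)` in law, where `M` is a symmetric `α`-stable random measure with
control measure `μ` and `f, g ∈ L^α(S, μ)`. The law of the pair of stable integrals is the
one with characteristic function `E exp(i(uξ + vη)) = exp(-‖uf + vg‖_α^α)`. In particular the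
scale coefficients of `ξ` and `η` are `‖f‖_α` and `‖g‖_α`. -/
structure IsStablePair {Ω S : Type*} [MeasurableSpace Ω] [MeasurableSpace S] (α : ℝ)
    (P : Measure Ω) (ξ η : Ω → ℝ) (μ : Measure S) (f g : S → ℝ) : Prop where
  aemeasurable_fst : AEMeasurable ξ P
  aemeasurable_snd : AEMeasurable η P
  memLp_fst : MemLp f (ENNReal.ofReal α) μ
  memLp_snd : MemLp g (ENNReal.ofReal α) μ
  charFun_eq : ∀ u v : ℝ,
    ∫ ω, Complex.exp (Complex.I * ((u * ξ ω + v * η ω : ℝ) : ℂ)) ∂P =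
      ((Real.exp (-(alphaNorm α μ (fun s => u * f s + v * g s)) ^ α) : ℝ) : ℂ)

/-- `[ξ, η]₁^* = ∫ |f|^{α-1} |g| dμ`, where `f` represents `ξ` and `g` represents `η`. -/
noncomputable def depOneStar {S : Type*} [MeasurableSpace S] (α : ℝ) (μ : Measure S)
    (f g : S → ℝ) : ℝ :=
  ∫ s, |f s| ^ (α - 1) * |g s| ∂μ

/-- `[ξ, η]₂ = ∫ |f g|^{α/2} dμ`, where `f` represents `ξ` and `g` represents `η`. -/
noncomputable def depTwo {S : Type*} [MeasurableSpace S] (α : ℝ) (μ : Measure S)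
    (f g : S → ℝ) : ℝ :=
  ∫ s, |f s * g s| ^ (α / 2) ∂μ

/-- `‖f‖_α^{α/2} ‖g‖_α^{α/2} - ∫ |fg|^{α/2} dμ ≥ ε₁ ‖f‖_α^{α/2} ‖g‖_α^{α/2}`. -/
def AssumptionA1 {S : Type*} [MeasurableSpace S] (α : ℝ) (μ : Measure S) (f g : S → ℝ)
    (ε₁ : ℝ) : Prop :=
  alphaNorm α μ f ^ (α / 2) * alphaNorm α μ g ^ (α / 2) - ∫ s, |f s * g s| ^ (α / 2) ∂μ ≥
    ε₁ * (alphaNorm α μ f ^ (α / 2) * alphaNorm α μ g ^ (α / 2))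

/-- `‖uf + vg‖_α^α ≥ ε₂ (‖uf‖_α^α + ‖vg‖_α^α)` for all real `u, v`. -/
def AssumptionA2 {S : Type*} [MeasurableSpace S] (α : ℝ) (μ : Measure S) (f g : S → ℝ)
    (ε₂ : ℝ) : Prop :=
  ∀ u v : ℝ, alphaNorm α μ (fun s => u * f s + v * g s) ^ α ≥
    ε₂ * (alphaNorm α μ (fun s => u * f s) ^ α + alphaNorm α μ (fun s => v * g s) ^ α)

/-- Growth bound `|K(x)| ≤ κ |x|^β` for `|x| > x₀`. -/
def AssumptionK1 (K : ℝ → ℝ) (β κ x₀ : ℝ) : Prop :=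
  ∀ x : ℝ, x₀ < |x| → |K x| ≤ κ * |x| ^ β

/-- Monotonicity beyond the level `x₀`: `K(x)/x` is non-increasing for `x > x₀` and monotone
for `x < -x₀`. Both directions are admitted on the negative side: `sign(x)|x|^β` needs
`MonotoneOn` there and `|x|^β` needs `AntitoneOn`. -/
def AssumptionK2 (K : ℝ → ℝ) (x₀ : ℝ) : Prop :=
  AntitoneOn (fun x => K x / x) (Set.Ioi x₀) ∧
    (MonotoneOn (fun x => K x / x) (Set.Iio (-x₀)) ∨
      AntitoneOn (fun x => K x / x) (Set.Iio (-x₀)))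

/-- `K_b(x) = K(x) 1_{|x| > b}`. -/
noncomputable def cutoff (K : ℝ → ℝ) (b : ℝ) : ℝ → ℝ :=
  Set.indicator {x : ℝ | b < |x|} K

/-! The argument is Fourier-analytic, with one factor `ξ` kept outside the Fourier transform. Since
`α > 1`, `ξ` is integrable, and `E[ξ e^{i(uξ+vη)}]` is found by differentiating the explicit
characteristic function in `u`. Hence `R(u,v) = E[ξ e^{i(uξ+vη)}] - E[ξ e^{iuξ}] E[e^{ivη}]`
(`expCov`) is explicit. Power inequalities bring out the factors `[η,ξ]₁^*` and `[η,ξ]₂`, and (A2)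
supplies exponential decay, so `|R(u,v)| ≤ M ([η,ξ]₁^* + [η,ξ]₂) / ((1+u²)(1+v²))`
(`IsStablePair.norm_expCov_le`, `exists_expCov_majorant`).

For the truncation `ξ 1_{a<ξ≤t}`, replace the indicator by a smooth bump with Fourier transform `h`
and take `L` smooth with transform `k`. The covariance becomes `∫∫ h(u) k(v) R(2πu,2πv) dv du`. Here
`|k| ≤ ‖L‖₁`, while `|h(u)| ≤ min(t, 1/|u|)`, so the double integral costs only a factor `log(1+t)`
(`abs_cov_smoothBump_le`). Dominated convergence restores the indicator, and density of test
functions in `L¹`, with a bounded density for `η`, restores a general `L` (`abs_cov_indicator_le`).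

Finally write `K(x) = x k(x)` with `k` antitone on `(b,∞)`. Its superlevel sets `{k > s}` are
intervals `(b,t(s)]` up to an endpoint, with `t(s) ≤ b (M'/s)^{1/(1-β)}` and `M' = κ b^{β-1} ≥ sup
k`. Integrating `log(1+t(s))` over `s ∈ (0,M']` gives at most `M' (log(1+b) + 1/(1-β))`, which is
the rate claimed (`abs_cov_of_antitone_le`). The negative half-line is the same statement for `-ξ`.
-/

/-! ### Power and exponential inequalities -/

lemma rpow_sub_rpow_le_sub_rpow {p x y : ℝ} (hp₀ : 0 ≤ p) (hp₁ : p ≤ 1) (hy : 0 ≤ y)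
    (hyx : y ≤ x) : |x ^ p - y ^ p| ≤ (x - y) ^ p := by
  have h1 : y ^ p ≤ x ^ p := Real.rpow_le_rpow hy hyx hp₀
  rw [abs_of_nonneg (by linarith)]
  have := Real.rpow_add_le_add_rpow (p := p) (sub_nonneg.2 hyx) hy hp₀ hp₁
  rw [sub_add_cancel] at this
  linarith

lemma abs_rpow_sub_two_mul_self_of_nonneg {α x : ℝ} (hα : 1 < α) (hx : 0 ≤ x) :
    |x| ^ (α - 2) * x = x ^ (α - 1) := by
  rcases hx.eq_or_lt with rfl | hx
  · simp [Real.zero_rpow (show α - 1 ≠ 0 by linarith)]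
  · rw [abs_of_pos hx, show α - 1 = (α - 2) + 1 by ring, Real.rpow_add_one hx.ne']

lemma abs_abs_rpow_sub_two_mul_self {α : ℝ} (hα : 1 < α) (x : ℝ) :
    |(|x| ^ (α - 2) * x)| = |x| ^ (α - 1) := by
  rw [abs_mul, abs_of_nonneg (by positivity), ← abs_rpow_sub_two_mul_self_of_nonneg hα (abs_nonneg x),
    abs_abs]

/-- The signed power is the odd extension of `x ^ (α - 1)`, which is subadditive on `x ≥ 0` because
`0 < α - 1 < 1`. For opposite signs `|x|` and `|y|` are each at most `|x - y|`, whence the factor 2.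
-/
lemma abs_rpow_sub_two_mul_self_sub_le {α : ℝ} (hα₁ : 1 < α) (hα₂ : α < 2) (x y : ℝ) :
    |(|x| ^ (α - 2) * x - |y| ^ (α - 2) * y)| ≤ 2 * |x - y| ^ (α - 1) := by
  wlog hyx : y ≤ x generalizing x y
  · rw [abs_sub_comm, abs_sub_comm x y]
    exact this y x (le_of_not_ge hyx)
  have hp : 0 ≤ |x - y| ^ (α - 1) := by positivity
  have neg : ∀ z : ℝ, z ≤ 0 → |z| ^ (α - 2) * z = -((-z) ^ (α - 1)) := fun z hz ↦ by
    rw [← abs_rpow_sub_two_mul_self_of_nonneg hα₁ (neg_nonneg.2 hz), abs_neg]; ring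
  rcases le_total 0 y with hy | hy
  · rw [abs_rpow_sub_two_mul_self_of_nonneg hα₁ hy,
      abs_rpow_sub_two_mul_self_of_nonneg hα₁ (hy.trans hyx)]
    have := rpow_sub_rpow_le_sub_rpow (p := α - 1) (by linarith) (by linarith) hy hyx
    rw [abs_of_nonneg (sub_nonneg.2 hyx)] at *
    linarith
  rcases le_total 0 x with hx | hx
  · rw [neg y hy, abs_rpow_sub_two_mul_self_of_nonneg hα₁ hx, sub_neg_eq_add,
      abs_of_nonneg (sub_nonneg.2 hyx), abs_of_nonneg (add_nonneg (Real.rpow_nonneg hx _) (Real.rpow_nonneg (by linarith) _))]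
    have h1 : x ^ (α - 1) ≤ (x - y) ^ (α - 1) :=
      Real.rpow_le_rpow hx (by linarith) (by linarith)
    have h2 : (-y) ^ (α - 1) ≤ (x - y) ^ (α - 1) :=
      Real.rpow_le_rpow (by linarith) (by linarith) (by linarith)
    linarith
  · rw [neg y hy, neg x hx]
    have := rpow_sub_rpow_le_sub_rpow (p := α - 1) (by linarith) (by linarith)
      (neg_nonneg.2 hx) (neg_le_neg hyx)
    rw [show -y - -x = x - y by ring] at this
    rw [abs_of_nonneg (sub_nonneg.2 hyx)] at *
    rw [show -(-x) ^ (α - 1) - -(-y) ^ (α - 1) = (-y) ^ (α - 1) - (-x) ^ (α - 1) by ring]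
    linarith

/-- Take `|b| ≤ |a|`. By the mean value theorem on `[-2|a|, 2|a|]` the increment of `|·|^α` is at
most `4 |a|^{α-1} |b|`, and `α < 2` lets `|b|^{1-α/2}` be raised to `|a|^{1-α/2}`. The leftover
`|b|^α` accounts for the fifth unit. -/
lemma abs_abs_add_rpow_sub_sub_le {α : ℝ} (hα₁ : 1 < α) (hα₂ : α < 2) (a b : ℝ) :
    |(|a + b| ^ α - |a| ^ α - |b| ^ α)| ≤ 5 * |a * b| ^ (α / 2) := by
  wlog hab : |b| ≤ |a| generalizing a b
  · have := this b a (le_of_not_ge hab)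
    rw [add_comm a b, mul_comm a b]
    convert! this using 2
    ring
  have hderiv : ∀ x ∈ Set.Icc (-(2 * |a|)) (2 * |a|),
      HasDerivWithinAt (fun x : ℝ ↦ |x| ^ α) (α * |x| ^ (α - 2) * x)
        (Set.Icc (-(2 * |a|)) (2 * |a|)) x :=
    fun x _ ↦ (hasDerivAt_abs_rpow x hα₁).hasDerivWithinAt
  have hbound : ∀ x ∈ Set.Icc (-(2 * |a|)) (2 * |a|), ‖α * |x| ^ (α - 2) * x‖ ≤ 4 * |a| ^ (α - 1) := by
    intro x hx
    have hx' : |x| ≤ 2 * |a| := abs_le.2 hx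
    rw [mul_assoc, norm_mul, Real.norm_eq_abs, Real.norm_eq_abs,
      abs_abs_rpow_sub_two_mul_self hα₁, abs_of_pos (by linarith)]
    calc α * |x| ^ (α - 1) ≤ 2 * (2 * |a| ^ (α - 1)) := by
          gcongr
          calc |x| ^ (α - 1) ≤ (2 * |a|) ^ (α - 1) :=
                Real.rpow_le_rpow (abs_nonneg _) hx' (by linarith)
            _ = 2 ^ (α - 1) * |a| ^ (α - 1) := Real.mul_rpow (by norm_num) (abs_nonneg _)
            _ ≤ 2 * |a| ^ (α - 1) := by
              gcongr
              exact (Real.rpow_le_rpow_of_exponent_le (by norm_num) (by linarith : α - 1 ≤ 1)).trans_eq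
                (Real.rpow_one 2)
      _ = _ := by ring
  have hmem : a ∈ Set.Icc (-(2 * |a|)) (2 * |a|) :=
    abs_le.1 (by linarith [abs_nonneg a])
  have hmem' : a + b ∈ Set.Icc (-(2 * |a|)) (2 * |a|) :=
    abs_le.1 (by linarith [abs_add_le a b])
  have h1 := (convex_Icc _ _).norm_image_sub_le_of_norm_hasDerivWithin_le hderiv hbound hmem hmem'
  simp only [Real.norm_eq_abs, add_sub_cancel_left] at h1
  have h2 : |a * b| ^ (α / 2) = |a| ^ (α / 2) * |b| ^ (α / 2) := by
    rw [abs_mul, Real.mul_rpow (abs_nonneg _) (abs_nonneg _)]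
  have h3 : |a| ^ (α - 1) * |b| ≤ |a| ^ (α / 2) * |b| ^ (α / 2) := by
    rcases (abs_nonneg b).eq_or_lt with hb | hb
    · rw [← hb]; simp; positivity
    have ha := hb.trans_le hab
    calc |a| ^ (α - 1) * |b| = |a| ^ (α - 1) * (|b| ^ (1 - α / 2) * |b| ^ (α / 2)) := by
          rw [← Real.rpow_add hb]; simp
      _ ≤ |a| ^ (α - 1) * (|a| ^ (1 - α / 2) * |b| ^ (α / 2)) := by
          gcongr; linarith
      _ = _ := by
          rw [← mul_assoc, ← Real.rpow_add ha]; ring_nf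
  have h4 : |b| ^ α ≤ |a| ^ (α / 2) * |b| ^ (α / 2) := by
    calc |b| ^ α = |b| ^ (α / 2) * |b| ^ (α / 2) := by
          rw [← Real.rpow_add_of_nonneg (abs_nonneg _) (by linarith) (by linarith)]; ring_nf
      _ ≤ _ := by gcongr
  rw [h2]
  calc |(|a + b| ^ α - |a| ^ α - |b| ^ α)| ≤ |(|a + b| ^ α - |a| ^ α)| + |(|b| ^ α)| := abs_sub _ _
    _ ≤ _ := by
      rw [abs_of_nonneg (show 0 ≤ |b| ^ α by positivity)]
      linarith

lemma abs_exp_neg_sub_exp_neg_le {x y m : ℝ} (hx : m ≤ x) (hy : m ≤ y) :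
    |Real.exp (-x) - Real.exp (-y)| ≤ |x - y| * Real.exp (-m) := by
  wlog hxy : x ≤ y generalizing x y
  · rw [abs_sub_comm, abs_sub_comm x y]; exact this hy hx (le_of_not_ge hxy)
  have h1 : Real.exp (-y) = Real.exp (-x) * Real.exp (-(y - x)) := by rw [← Real.exp_add]; ring_nf
  have h2 := Real.one_sub_le_exp_neg (y - x)
  have h3 : Real.exp (-x) ≤ Real.exp (-m) := Real.exp_le_exp.2 (by linarith)
  have h4 : Real.exp (-y) ≤ Real.exp (-x) := Real.exp_le_exp.2 (by linarith)
  rw [abs_of_nonneg (by linarith), abs_sub_comm, abs_of_nonneg (by linarith)]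
  calc _ ≤ (y - x) * Real.exp (-x) := by
        rw [h1]; nlinarith [Real.exp_pos (-x)]
    _ ≤ _ := by gcongr

/-- A stretched exponential times a power decays at least like the Cauchy kernel. -/
lemma exists_rpow_mul_exp_neg_le {α c p : ℝ} (hα : 0 < α) (hc : 0 < c) (hp : 0 ≤ p) :
    ∃ M : ℝ, 0 < M ∧ ∀ u : ℝ, |u| ^ p * Real.exp (-(c * |u| ^ α)) ≤ M / (1 + u ^ 2) := by
  -- Boundedness for the exponents `p` and `p + 2` together gives the Cauchy-type decay. Each
  -- follows from a single term `(c|u|^α)^n / n!` of the exponential series with `αn ≥ q`.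
  have key : ∀ q : ℝ, 0 ≤ q → ∃ M : ℝ, 0 < M ∧ ∀ u : ℝ, |u| ^ q * Real.exp (-(c * |u| ^ α)) ≤ M := by
    intro q hq
    obtain ⟨n, hn⟩ := exists_nat_ge (q / α)
    rw [div_le_iff₀ hα] at hn
    refine ⟨1 + n.factorial / c ^ n, by positivity, fun u ↦ ?_⟩
    have h1 : |u| ^ q ≤ 1 + (|u| ^ α) ^ n := by
      rw [← Real.rpow_mul_natCast (abs_nonneg u)]
      rcases le_total |u| 1 with h | h
      · have := Real.rpow_le_one (abs_nonneg u) h hq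
        have : 0 ≤ |u| ^ (α * n) := by positivity
        linarith
      · have := Real.rpow_le_rpow_of_exponent_le h (by linarith : q ≤ α * n)
        linarith
    have h2 := Real.pow_div_factorial_le_exp (c * |u| ^ α) (by positivity) n
    have h3 : (|u| ^ α) ^ n ≤ n.factorial / c ^ n * Real.exp (c * |u| ^ α) := by
      rw [mul_pow, div_le_iff₀ (by positivity)] at h2
      rw [div_mul_eq_mul_div, le_div_iff₀ (by positivity)]
      linarith
    have h4 : 1 ≤ Real.exp (c * |u| ^ α) := Real.one_le_exp (by positivity)
    rw [Real.exp_neg, ← div_eq_mul_inv, div_le_iff₀ (Real.exp_pos _)]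
    linarith
  obtain ⟨M₁, hM₁, h₁⟩ := key p hp
  obtain ⟨M₂, hM₂, h₂⟩ := key (p + 2) (by linarith)
  refine ⟨M₁ + M₂, by positivity, fun u ↦ ?_⟩
  rw [le_div_iff₀ (by positivity)]
  have h3 : |u| ^ (p + 2) = |u| ^ p * u ^ 2 := by
    rw [Real.rpow_add_of_nonneg (abs_nonneg _) hp (by norm_num)]
    norm_num
  have := h₁ u
  have := h₂ u
  rw [h3] at this
  nlinarith

/-! ### Integrals against the control measure -/

section integrals
variable {S : Type*} [MeasurableSpace S] {α : ℝ} {μ : Measure S} {f g : S → ℝ}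

lemma alphaNorm_rpow (hα : 0 < α) (μ : Measure S) (f : S → ℝ) :
    alphaNorm α μ f ^ α = ∫ s, |f s| ^ α ∂μ := by
  rw [alphaNorm, ← Real.rpow_mul (integral_nonneg fun s ↦ by positivity), one_div,
    inv_mul_cancel₀ hα.ne', Real.rpow_one]

lemma integral_abs_const_mul_rpow (μ : Measure S) (f : S → ℝ) (u : ℝ) :
    ∫ s, |u * f s| ^ α ∂μ = |u| ^ α * ∫ s, |f s| ^ α ∂μ := by
  rw [← integral_const_mul]
  congr with s
  rw [abs_mul, Real.mul_rpow (abs_nonneg _) (abs_nonneg _)]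

lemma MeasureTheory.MemLp.integrable_abs_rpow (hα : 0 < α) (hf : MemLp f (ENNReal.ofReal α) μ) :
    Integrable (fun s ↦ |f s| ^ α) μ := by
  have := hf.integrable_norm_rpow (by simpa using hα) ENNReal.ofReal_ne_top
  rw [ENNReal.toReal_ofReal hα.le] at this
  exact this

lemma rpow_mul_rpow_le_add {a b p q r : ℝ} (ha : 0 ≤ a) (hb : 0 ≤ b) (hp : 0 ≤ p) (hq : 0 ≤ q)
    (hr : p + q = r) : a ^ p * b ^ q ≤ a ^ r + b ^ r := by
  subst hr
  rw [Real.rpow_add_of_nonneg ha hp hq, Real.rpow_add_of_nonneg hb hp hq]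
  rcases le_total a b with h | h
  · have : a ^ p * b ^ q ≤ b ^ p * b ^ q := by gcongr
    have : 0 ≤ a ^ p * a ^ q := by positivity
    linarith
  · have : a ^ p * b ^ q ≤ a ^ p * a ^ q := by gcongr
    have : 0 ≤ b ^ p * b ^ q := by positivity
    linarith

lemma integrable_rpow_mul_rpow {p q : ℝ} (hp : 0 ≤ p) (hq : 0 ≤ q) (hpq : p + q = α) (hα : 0 < α)
    (hf : MemLp f (ENNReal.ofReal α) μ) (hg : MemLp g (ENNReal.ofReal α) μ) :
    Integrable (fun s ↦ |f s| ^ p * |g s| ^ q) μ := by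
  refine ((hf.integrable_abs_rpow hα).add (hg.integrable_abs_rpow hα)).mono' ?_ ?_
  · have h1 := hf.aestronglyMeasurable.aemeasurable
    have h2 := hg.aestronglyMeasurable.aemeasurable
    exact AEMeasurable.aestronglyMeasurable (by fun_prop)
  · filter_upwards with s
    rw [Real.norm_of_nonneg (by positivity)]
    exact rpow_mul_rpow_le_add (abs_nonneg _) (abs_nonneg _) hp hq hpq

lemma integrable_depOneStar (hα : 1 < α)
    (hf : MemLp f (ENNReal.ofReal α) μ) (hg : MemLp g (ENNReal.ofReal α) μ) :
    Integrable (fun s ↦ |f s| ^ (α - 1) * |g s|) μ := by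
  simpa using integrable_rpow_mul_rpow (p := α - 1) (q := 1) (by linarith) (by norm_num) (by ring)
    (by linarith) hf hg

lemma integrable_depTwo (hα : 0 < α)
    (hf : MemLp f (ENNReal.ofReal α) μ) (hg : MemLp g (ENNReal.ofReal α) μ) :
    Integrable (fun s ↦ |f s * g s| ^ (α / 2)) μ := by
  simp_rw [abs_mul, Real.mul_rpow (abs_nonneg _) (abs_nonneg _)]
  exact integrable_rpow_mul_rpow (by linarith) (by linarith) (by ring) hα hf hg

lemma depOneStar_nonneg : 0 ≤ depOneStar α μ f g := integral_nonneg fun s ↦ by positivity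

lemma depTwo_nonneg : 0 ≤ depTwo α μ f g := integral_nonneg fun s ↦ by positivity

lemma memLp_lincomb (hf : MemLp f (ENNReal.ofReal α) μ) (hg : MemLp g (ENNReal.ofReal α) μ)
    (u v : ℝ) : MemLp (fun s ↦ u * f s + v * g s) (ENNReal.ofReal α) μ :=
  (hf.const_mul u).add (hg.const_mul v)

lemma integrable_signedPow_mul (hα : 1 < α)
    (hf : MemLp f (ENNReal.ofReal α) μ) (hg : MemLp g (ENNReal.ofReal α) μ) :
    Integrable (fun s ↦ |f s| ^ (α - 2) * f s * g s) μ := by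
  refine (integrable_depOneStar hα hf hg).mono' ?_ ?_
  · have h1 := hf.aestronglyMeasurable.aemeasurable
    have h2 := hg.aestronglyMeasurable.aemeasurable
    exact AEMeasurable.aestronglyMeasurable (by fun_prop)
  · filter_upwards with s
    rw [norm_mul, Real.norm_eq_abs, Real.norm_eq_abs, abs_abs_rpow_sub_two_mul_self hα]

/-- Source of `[η,ξ]₁^*`: the signed power is `(α-1)`-Hölder, and its argument moves by `v g`. -/
lemma abs_integral_signedPow_sub_le (hα₁ : 1 < α) (hα₂ : α < 2)
    (hf : MemLp f (ENNReal.ofReal α) μ) (hg : MemLp g (ENNReal.ofReal α) μ) (u v : ℝ) :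
    |(∫ s, |u * f s + v * g s| ^ (α - 2) * (u * f s + v * g s) * f s ∂μ)
      - ∫ s, |u * f s| ^ (α - 2) * (u * f s) * f s ∂μ| ≤
      2 * |v| ^ (α - 1) * depOneStar α μ g f := by
  rw [← integral_sub (integrable_signedPow_mul hα₁ (memLp_lincomb hf hg u v) hf)
    (integrable_signedPow_mul hα₁ (hf.const_mul u) hf), depOneStar, ← integral_const_mul]
  rw [← Real.norm_eq_abs]
  refine norm_integral_le_of_norm_le ((integrable_depOneStar hα₁ hg hf).const_mul _) ?_
  filter_upwards with s
  rw [← sub_mul, norm_mul, Real.norm_eq_abs, Real.norm_eq_abs]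
  have := abs_rpow_sub_two_mul_self_sub_le hα₁ hα₂ (u * f s + v * g s) (u * f s)
  rw [add_sub_cancel_left, abs_mul v, Real.mul_rpow (abs_nonneg _) (abs_nonneg _)] at this
  exact (mul_le_mul_of_nonneg_right this (abs_nonneg (f s))).trans_eq (by ring)

lemma abs_integral_signedPow_le (hα₁ : 1 < α) (hf : MemLp f (ENNReal.ofReal α) μ) (u : ℝ) :
    |∫ s, |u * f s| ^ (α - 2) * (u * f s) * f s ∂μ| ≤ |u| ^ (α - 1) * ∫ s, |f s| ^ α ∂μ := by
  rw [← integral_const_mul]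
  rw [← Real.norm_eq_abs]
  refine norm_integral_le_of_norm_le ((hf.integrable_abs_rpow (by linarith)).const_mul _) ?_
  filter_upwards with s
  rw [norm_mul, Real.norm_eq_abs, Real.norm_eq_abs, abs_abs_rpow_sub_two_mul_self hα₁, abs_mul,
    Real.mul_rpow (abs_nonneg _) (abs_nonneg _), mul_assoc]
  gcongr
  conv_rhs => rw [show α = (α - 1) + 1 by ring,
    Real.rpow_add_of_nonneg (abs_nonneg _) (by linarith) zero_le_one, Real.rpow_one]

/-- Source of `[η,ξ]₂`: the defect of additivity of the scale, integrated pointwise. -/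
lemma abs_integral_lincomb_rpow_sub_le (hα₁ : 1 < α) (hα₂ : α < 2)
    (hf : MemLp f (ENNReal.ofReal α) μ) (hg : MemLp g (ENNReal.ofReal α) μ) (u v : ℝ) :
    |(∫ s, |u * f s + v * g s| ^ α ∂μ) - ((∫ s, |u * f s| ^ α ∂μ) + ∫ s, |v * g s| ^ α ∂μ)| ≤
      5 * (|u| ^ (α / 2) * |v| ^ (α / 2)) * depTwo α μ g f := by
  have hα : 0 < α := by linarith
  have i1 := (hf.const_mul u).integrable_abs_rpow hα
  have i2 := (hg.const_mul v).integrable_abs_rpow hα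
  have i3 := (memLp_lincomb hf hg u v).integrable_abs_rpow hα
  rw [← sub_sub, ← integral_sub i3 i1, ← integral_sub (f := fun s ↦ |u * f s + v * g s| ^ α - |u * f s| ^ α)
    (i3.sub i1) i2, depTwo, ← integral_const_mul]
  rw [← Real.norm_eq_abs]
  refine norm_integral_le_of_norm_le ((integrable_depTwo hα hg hf).const_mul _) ?_
  filter_upwards with s
  refine (abs_abs_add_rpow_sub_sub_le hα₁ hα₂ (u * f s) (v * g s)).trans_eq ?_
  rw [mul_mul_mul_comm, mul_comm (f s), abs_mul, abs_mul u,
    Real.mul_rpow (by positivity) (by positivity), Real.mul_rpow (by positivity) (by positivity)]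
  ring

end integrals

/-! ### One-dimensional stable laws: tails and degeneracy -/

section stableLaw
variable {ν : Measure ℝ} [IsProbabilityMeasure ν] {α c : ℝ}

/-- Tails are controlled by the average of `1 - charFun` over `|t| ≤ 2/r`, where `1 - e^{-x} ≤ x`
applies. For `α > 1` this yields a first moment; for `c = 0` it forces the law to be the point mass
at 0. -/
lemma measureReal_lt_abs_le_of_charFun (hα : 0 ≤ α) (hc : 0 ≤ c)
    (h : ∀ t, charFun ν t = (Real.exp (-(|t| ^ α * c)) : ℝ)) {r : ℝ} (hr : 0 < r) :
    ν.real {x | r < |x|} ≤ 2 * 2 ^ α * c * r ^ (-α) := by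
  refine (measureReal_abs_gt_le_integral_charFun hr).trans ?_
  have h1 : ∀ t ∈ Set.uIoc (-2 * r⁻¹) (2 * r⁻¹), ‖1 - charFun ν t‖ ≤ (2 * r⁻¹) ^ α * c := by
    intro t ht
    have hr' : -2 * r⁻¹ ≤ 2 * r⁻¹ := by have : 0 < r⁻¹ := by positivity
                                        linarith
    rw [Set.uIoc_of_le hr'] at ht
    have ht' : |t| ≤ 2 * r⁻¹ := abs_le.2 ⟨by linarith [ht.1], ht.2⟩
    rw [h t, ← Complex.ofReal_one, ← Complex.ofReal_sub, Complex.norm_real, Real.norm_eq_abs,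
      abs_of_nonneg (sub_nonneg.2 (Real.exp_le_one_iff.2 (neg_nonpos.2 (by positivity))))]
    have := Real.one_sub_le_exp_neg (|t| ^ α * c)
    have : |t| ^ α * c ≤ (2 * r⁻¹) ^ α * c := by gcongr
    linarith
  have h2 := intervalIntegral.norm_integral_le_of_norm_le_const h1
  calc _ ≤ 2⁻¹ * r * ((2 * r⁻¹) ^ α * c * |2 * r⁻¹ - -2 * r⁻¹|) := by gcongr
    _ = _ := by
      rw [show 2 * r⁻¹ - -2 * r⁻¹ = 4 * r⁻¹ by ring, abs_of_pos (by positivity),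
        Real.mul_rpow (by norm_num) (by positivity), Real.inv_rpow hr.le, ← Real.rpow_neg hr.le]
      field_simp
      norm_num [mul_comm]

lemma integrable_id_of_charFun (hα : 1 < α) (hc : 0 ≤ c)
    (h : ∀ t, charFun ν t = (Real.exp (-(|t| ^ α * c)) : ℝ)) : Integrable (fun x : ℝ ↦ x) ν := by
  rw [← integrable_norm_iff (by fun_prop)]
  refine ⟨by fun_prop, ?_⟩
  rw [hasFiniteIntegral_iff_norm]
  simp only [Real.norm_eq_abs, abs_abs]
  rw [lintegral_eq_lintegral_meas_lt ν (ae_of_all _ fun x ↦ abs_nonneg x) (by fun_prop),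
    ← Set.Ioc_union_Ioi_eq_Ioi (zero_le_one' ℝ),
    lintegral_union measurableSet_Ioi (Set.Ioc_disjoint_Ioi le_rfl)]
  refine ENNReal.add_lt_top.2 ⟨?_, ?_⟩
  · calc _ ≤ ∫⁻ _ in Set.Ioc (0 : ℝ) 1, 1 := lintegral_mono fun t ↦ prob_le_one
      _ < ⊤ := by simp
  · have hint : IntegrableOn (fun t : ℝ ↦ 2 * 2 ^ α * c * t ^ (-α)) (Set.Ioi 1) :=
      (integrableOn_Ioi_rpow_of_lt (by linarith) zero_lt_one).const_mul _
    refine lt_of_le_of_lt (setLIntegral_mono' measurableSet_Ioi fun t ht ↦ ?_)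
      hint.lintegral_lt_top
    have ht' : (0 : ℝ) < t := zero_lt_one.trans ht
    rw [← ofReal_measureReal]
    exact ENNReal.ofReal_le_ofReal (measureReal_lt_abs_le_of_charFun (by linarith) hc h ht')

lemma ae_eq_zero_of_charFun (hα : 0 ≤ α) (h : ∀ t, charFun ν t = (Real.exp (-(|t| ^ α * 0)) : ℝ)) :
    ∀ᵐ x ∂ν, x = 0 := by
  have h1 : ∀ n : ℕ, ∀ᵐ x ∂ν, |x| ≤ 1 / ((n : ℝ) + 1) := by
    intro n
    have h2 := measureReal_lt_abs_le_of_charFun hα le_rfl h (r := 1 / ((n : ℝ) + 1)) (by positivity)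
    rw [mul_zero, zero_mul] at h2
    have h3 := (measureReal_eq_zero_iff (by finiteness)).1 (le_antisymm h2 measureReal_nonneg)
    rw [ae_iff]
    simpa using h3
  filter_upwards [ae_all_iff.2 h1] with x hx
  refine abs_nonpos_iff.1 (le_of_forall_pos_le_add fun ε hε ↦ ?_)
  obtain ⟨n, hn⟩ := exists_nat_one_div_lt hε
  linarith [hx n]

end stableLaw

/-! ### Derivatives in `u` and the decay of `expCov` -/

section derivative
variable {S : Type*} [MeasurableSpace S] {α : ℝ} {μ : Measure S} {f g : S → ℝ}

lemma hasDerivAt_integral_lincomb_rpow (hα₁ : 1 < α)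
    (hf : MemLp f (ENNReal.ofReal α) μ) (hg : MemLp g (ENNReal.ofReal α) μ) (u v : ℝ) :
    HasDerivAt (fun u ↦ ∫ s, |u * f s + v * g s| ^ α ∂μ)
      (α * ∫ s, |u * f s + v * g s| ^ (α - 2) * (u * f s + v * g s) * f s ∂μ) u := by
  have hα : 0 < α := by linarith
  have hbd : MemLp (fun s ↦ (|u| + 1) * |f s| + |v| * |g s|) (ENNReal.ofReal α) μ :=
    memLp_lincomb hf.abs hg.abs _ _
  have key := (hasDerivAt_integral_of_dominated_loc_of_deriv_le (μ := μ)
    (F := fun u s ↦ |u * f s + v * g s| ^ α)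
    (F' := fun u s ↦ α * (|u * f s + v * g s| ^ (α - 2) * (u * f s + v * g s) * f s))
    (bound := fun s ↦ α * (|((|u| + 1) * |f s| + |v| * |g s|)| ^ (α - 1) * |f s|))
    (Metric.ball_mem_nhds u one_pos)
    (.of_forall fun x ↦ ((memLp_lincomb hf hg x v).integrable_abs_rpow hα).aestronglyMeasurable)
    ((memLp_lincomb hf hg u v).integrable_abs_rpow hα)
    ((integrable_signedPow_mul hα₁ (memLp_lincomb hf hg u v) hf).const_mul α).aestronglyMeasurable
    (ae_of_all _ fun s x hx ↦ ?_)
    ((integrable_depOneStar hα₁ hbd hf).const_mul α)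
    (ae_of_all _ fun s x hx ↦ ?_)).2
  · rwa [integral_const_mul] at key
  · rw [norm_mul, norm_mul, Real.norm_eq_abs, Real.norm_eq_abs, Real.norm_eq_abs,
      abs_abs_rpow_sub_two_mul_self hα₁, abs_of_pos hα]
    have hx' : |x| ≤ |u| + 1 := by
      have := abs_sub_abs_le_abs_sub x u
      rw [Metric.mem_ball, Real.dist_eq] at hx
      linarith
    gcongr ?_ * (?_ * _)
    refine Real.rpow_le_rpow (abs_nonneg _) ?_ (by linarith)
    rw [abs_of_nonneg (a := (|u| + 1) * |f s| + |v| * |g s|) (by positivity)]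
    refine (abs_add_le _ _).trans ?_
    rw [abs_mul, abs_mul]
    gcongr
  · have h1 : HasDerivAt (fun x ↦ x * f s + v * g s) (f s) x := by
      simpa using ((hasDerivAt_id x).mul_const (f s)).add_const (v * g s)
    convert! (hasDerivAt_abs_rpow (x * f s + v * g s) hα₁).comp x h1 using 1
    ring

end derivative

section charfun
variable {Ω : Type*} [MeasurableSpace Ω] {P : Measure Ω} [IsProbabilityMeasure P] {ξ η : Ω → ℝ}

lemma norm_exp_I_mul_ofReal (x : ℝ) : ‖Complex.exp (Complex.I * (x : ℂ))‖ = 1 := by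
  rw [mul_comm, Complex.norm_exp_ofReal_mul_I]

lemma hasDerivAt_integral_exp (hξ : Integrable ξ P) (hη : AEMeasurable η P) (u v : ℝ) :
    HasDerivAt (fun u : ℝ ↦ ∫ ω, Complex.exp (Complex.I * ((u * ξ ω + v * η ω : ℝ) : ℂ)) ∂P)
      (Complex.I * ∫ ω, (ξ ω : ℂ) * Complex.exp (Complex.I * ((u * ξ ω + v * η ω : ℝ) : ℂ)) ∂P) u := by
  have hξm := hξ.aemeasurable
  have hm : ∀ x : ℝ, AEMeasurable
      (fun ω ↦ Complex.exp (Complex.I * ((x * ξ ω + v * η ω : ℝ) : ℂ))) P := by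
    intro x; fun_prop
  have key := (hasDerivAt_integral_of_dominated_loc_of_deriv_le (μ := P) (x₀ := u)
    (F := fun (u : ℝ) ω ↦ Complex.exp (Complex.I * ((u * ξ ω + v * η ω : ℝ) : ℂ)))
    (F' := fun (u : ℝ) ω ↦
      Complex.I * ((ξ ω : ℂ) * Complex.exp (Complex.I * ((u * ξ ω + v * η ω : ℝ) : ℂ))))
    (bound := fun ω ↦ |ξ ω|)
    (Metric.ball_mem_nhds u one_pos)
    (.of_forall fun x ↦ (hm x).aestronglyMeasurable)
    (Integrable.of_bound (hm u).aestronglyMeasurable 1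
      (ae_of_all _ fun ω ↦ (norm_exp_I_mul_ofReal _).le))
    (AEMeasurable.aestronglyMeasurable (by fun_prop))
    (ae_of_all _ fun ω x _ ↦ ?_) hξ.abs
    (ae_of_all _ fun ω x _ ↦ ?_)).2
  · rwa [integral_const_mul] at key
  · rw [norm_mul, norm_mul, norm_exp_I_mul_ofReal]
    simp
  · have h1 : HasDerivAt (fun x : ℝ ↦ x * ξ ω + v * η ω) (ξ ω) x := by
      simpa using ((hasDerivAt_id x).mul_const (ξ ω)).add_const (v * η ω)
    have h2 := (h1.ofReal_comp.const_mul Complex.I).cexp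
    convert! h2 using 1
    ring

end charfun

/-- `E[ξ e^{i(uξ+vη)}] - E[ξ e^{iuξ}] E[e^{ivη}]`. -/
noncomputable def expCov {Ω : Type*} [MeasurableSpace Ω] (P : Measure Ω) (ξ η : Ω → ℝ)
    (u v : ℝ) : ℂ :=
  (∫ ω, (ξ ω : ℂ) * Complex.exp (Complex.I * ((u * ξ ω + v * η ω : ℝ) : ℂ)) ∂P) -
    (∫ ω, (ξ ω : ℂ) * Complex.exp (Complex.I * ((u * ξ ω : ℝ) : ℂ)) ∂P) *
      ∫ ω, Complex.exp (Complex.I * ((v * η ω : ℝ) : ℂ)) ∂P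

section
variable {Ω S : Type*} [MeasurableSpace Ω] [MeasurableSpace S] {P : Measure Ω}
  {μ : Measure S} {ξ η : Ω → ℝ} {f g : S → ℝ} {α : ℝ}

lemma IsStablePair.integral_exp_eq (hα : 0 < α) (h : IsStablePair α P ξ η μ f g) (u v : ℝ) :
    ∫ ω, Complex.exp (Complex.I * ((u * ξ ω + v * η ω : ℝ) : ℂ)) ∂P =
      ((Real.exp (-∫ s, |u * f s + v * g s| ^ α ∂μ) : ℝ) : ℂ) := by
  rw [h.charFun_eq, alphaNorm_rpow hα]

lemma IsStablePair.charFun_map_fst (hα : 0 < α) (h : IsStablePair α P ξ η μ f g) (t : ℝ) :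
    charFun (P.map ξ) t = (Real.exp (-(|t| ^ α * ∫ s, |f s| ^ α ∂μ)) : ℝ) := by
  have := h.integral_exp_eq hα t 0
  simp only [zero_mul, add_zero, integral_abs_const_mul_rpow] at this
  rw [← this, charFun_apply_real, integral_map h.aemeasurable_fst (by fun_prop)]
  congr with ω
  push_cast
  ring_nf

lemma IsStablePair.charFun_map_snd (hα : 0 < α) (h : IsStablePair α P ξ η μ f g) (t : ℝ) :
    charFun (P.map η) t = (Real.exp (-(|t| ^ α * ∫ s, |g s| ^ α ∂μ)) : ℝ) := by
  have := h.integral_exp_eq hα 0 t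
  simp only [zero_mul, zero_add, integral_abs_const_mul_rpow] at this
  rw [← this, charFun_apply_real, integral_map h.aemeasurable_snd (by fun_prop)]
  congr with ω
  push_cast
  ring_nf

variable [IsProbabilityMeasure P]

lemma IsStablePair.integrable_fst (hα : 1 < α) (h : IsStablePair α P ξ η μ f g) :
    Integrable ξ P := by
  have := Measure.isProbabilityMeasure_map (μ := P) h.aemeasurable_fst
  have h1 := integrable_id_of_charFun hα (integral_nonneg fun s ↦ by positivity)
    (h.charFun_map_fst (by linarith))
  exact (integrable_map_measure (by fun_prop) h.aemeasurable_fst).1 h1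

/-- The joint characteristic function is differentiated in `u` twice over, under the expectation and
in its closed form; the derivatives must agree. -/
lemma IsStablePair.integral_mul_exp_eq (hα : 1 < α) (h : IsStablePair α P ξ η μ f g) (u v : ℝ) :
    Complex.I * ∫ ω, (ξ ω : ℂ) * Complex.exp (Complex.I * ((u * ξ ω + v * η ω : ℝ) : ℂ)) ∂P =
      ((-(α * ∫ s, |u * f s + v * g s| ^ (α - 2) * (u * f s + v * g s) * f s ∂μ) *
        Real.exp (-∫ s, |u * f s + v * g s| ^ α ∂μ) : ℝ) : ℂ) := by
  have h1 := hasDerivAt_integral_exp (h.integrable_fst hα) h.aemeasurable_snd u v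
  have h2 := (hasDerivAt_integral_lincomb_rpow hα h.memLp_fst h.memLp_snd u v).fun_neg.exp.ofReal_comp
  simp_rw [h.integral_exp_eq (by linarith)] at h1
  rw [h1.unique h2, mul_comm]

lemma IsStablePair.norm_expCov_le (hα₁ : 1 < α) (hα₂ : α < 2)
    (h : IsStablePair α P ξ η μ f g) {ε : ℝ} (hA : AssumptionA2 α μ f g ε) (u v : ℝ) :
    ‖expCov P ξ η u v‖ ≤
      (α * (2 * |v| ^ (α - 1) * depOneStar α μ g f) +
        α * (|u| ^ (α - 1) * ∫ s, |f s| ^ α ∂μ) *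
          (5 * (|u| ^ (α / 2) * |v| ^ (α / 2)) * depTwo α μ g f)) *
      Real.exp (-(min ε 1 * (|u| ^ α * (∫ s, |f s| ^ α ∂μ) + |v| ^ α * ∫ s, |g s| ^ α ∂μ))) := by
  have hα : 0 < α := by linarith
  set A := ∫ s, |u * f s + v * g s| ^ (α - 2) * (u * f s + v * g s) * f s ∂μ with hA'
  set A₀ := ∫ s, |u * f s| ^ (α - 2) * (u * f s) * f s ∂μ with hA₀
  set N := ∫ s, |u * f s + v * g s| ^ α ∂μ with hN
  set N₁ := ∫ s, |u * f s| ^ α ∂μ with hN₁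
  set N₂ := ∫ s, |v * g s| ^ α ∂μ with hN₂
  have hN₁' : N₁ = |u| ^ α * ∫ s, |f s| ^ α ∂μ := integral_abs_const_mul_rpow μ f u
  have hN₂' : N₂ = |v| ^ α * ∫ s, |g s| ^ α ∂μ := integral_abs_const_mul_rpow μ g v
  rw [← hN₁', ← hN₂']
  have e1 := h.integral_mul_exp_eq hα₁ u v
  have e2 := h.integral_mul_exp_eq hα₁ u 0
  have e3 := h.integral_exp_eq hα 0 v
  simp only [zero_mul, add_zero, zero_add] at e2 e3
  rw [← hA', ← hN] at e1
  rw [← hA₀, ← hN₁] at e2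
  rw [← hN₂] at e3
  -- With `A₀` and `N₁ + N₂` the values under independence, one summand carries the change of
  -- prefactor and the other the change of exponent.
  have e4 : Complex.I * expCov P ξ η u v =
      ((-(α * (A - A₀)) * Real.exp (-N) + -(α * A₀) * (Real.exp (-N) - Real.exp (-(N₁ + N₂))) : ℝ) : ℂ) := by
    rw [expCov, mul_sub, e1, ← mul_assoc, e2, e3, ← Complex.ofReal_mul, ← Complex.ofReal_sub,
      neg_add, Real.exp_add]
    congr 1
    ring
  have e5 : ‖expCov P ξ η u v‖ = ‖Complex.I * expCov P ξ η u v‖ := by simp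
  rw [e5, e4, Complex.norm_real, Real.norm_eq_abs]
  have p1 : 0 ≤ N₁ := integral_nonneg fun s ↦ by positivity
  have p2 : 0 ≤ N₂ := integral_nonneg fun s ↦ by positivity
  -- The minimum with 1 makes one exponent serve as a lower bound for both `N` and `N₁ + N₂`.
  have hmN : min ε 1 * (N₁ + N₂) ≤ N := by
    have := hA u v
    simp only [alphaNorm_rpow hα] at this
    refine le_trans ?_ this
    gcongr
    exact min_le_left _ _
  have hm1 : min ε 1 * (N₁ + N₂) ≤ N₁ + N₂ :=
    mul_le_of_le_one_left (by positivity) (min_le_right _ _)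
  have b1 : |A - A₀| ≤ _ := abs_integral_signedPow_sub_le hα₁ hα₂ h.memLp_fst h.memLp_snd u v
  have b2 : |A₀| ≤ _ := abs_integral_signedPow_le hα₁ h.memLp_fst u
  have b3 : |N - (N₁ + N₂)| ≤ _ :=
    abs_integral_lincomb_rpow_sub_le hα₁ hα₂ h.memLp_fst h.memLp_snd u v
  have b4 := abs_exp_neg_sub_exp_neg_le hmN hm1
  have d1 : 0 ≤ depOneStar α μ g f := depOneStar_nonneg
  have d2 : 0 ≤ depTwo α μ g f := depTwo_nonneg
  refine (abs_add_le _ _).trans ?_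
  rw [add_mul]
  refine add_le_add ?_ ?_
  · rw [abs_mul, abs_neg, abs_mul, abs_of_pos hα, Real.abs_exp]
    gcongr
  · rw [abs_mul, abs_neg, abs_mul, abs_of_pos hα, mul_assoc (α * _)]
    have hf0 : 0 ≤ ∫ s, |f s| ^ α ∂μ := integral_nonneg fun s ↦ by positivity
    refine mul_le_mul ?_ (b4.trans ?_) (abs_nonneg _) (by positivity)
    · gcongr
    · gcongr

end

/-- `M` is fixed before `D₁, D₂, u, v`, and `a, b` will be powers of the prescribed scales. This is
why the final constant does not depend on `f`, `g` or `μ`. -/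
lemma exists_expCov_majorant {α m a b : ℝ} (hα : 1 < α) (hm : 0 < m) (ha : 0 < a) (hb : 0 < b) :
    ∃ M : ℝ, 0 < M ∧ ∀ D₁ D₂ u v : ℝ, 0 ≤ D₁ → 0 ≤ D₂ →
      (α * (2 * |v| ^ (α - 1) * D₁) +
        α * (|u| ^ (α - 1) * a) * (5 * (|u| ^ (α / 2) * |v| ^ (α / 2)) * D₂)) *
        Real.exp (-(m * (|u| ^ α * a + |v| ^ α * b))) ≤
      M * (D₁ + D₂) / ((1 + u ^ 2) * (1 + v ^ 2)) := by
  have hα₀ : 0 < α := by linarith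
  obtain ⟨M₁, hM₁, h₁⟩ := exists_rpow_mul_exp_neg_le hα₀ (mul_pos hm ha) le_rfl
  obtain ⟨M₂, hM₂, h₂⟩ := exists_rpow_mul_exp_neg_le (p := α - 1) hα₀ (mul_pos hm hb) (by linarith)
  obtain ⟨M₃, hM₃, h₃⟩ := exists_rpow_mul_exp_neg_le (p := α - 1 + α / 2) hα₀ (mul_pos hm ha)
    (by linarith)
  obtain ⟨M₄, hM₄, h₄⟩ := exists_rpow_mul_exp_neg_le (p := α / 2) hα₀ (mul_pos hm hb) (by linarith)
  refine ⟨2 * α * (M₁ * M₂) + 5 * α * a * (M₃ * M₄), by positivity,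
    fun D₁ D₂ u v hD₁ hD₂ ↦ ?_⟩
  have hexp : Real.exp (-(m * (|u| ^ α * a + |v| ^ α * b))) =
      Real.exp (-(m * a * |u| ^ α)) * Real.exp (-(m * b * |v| ^ α)) := by
    rw [← Real.exp_add]; ring_nf
  have hu := h₁ u
  rw [Real.rpow_zero, one_mul] at hu
  have hu3 := h₃ u
  rw [Real.rpow_add_of_nonneg (abs_nonneg _) (by linarith) (by linarith)] at hu3
  have k1 := mul_le_mul hu (h₂ v) (by positivity) (by positivity)
  have k2 := mul_le_mul hu3 (h₄ v) (by positivity) (by positivity)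
  rw [div_mul_div_comm] at k1 k2
  set X := (1 + u ^ 2) * (1 + v ^ 2) with hX
  have hX0 : 0 < X := by positivity
  calc _ = 2 * α * D₁ * (Real.exp (-(m * a * |u| ^ α)) *
            (|v| ^ (α - 1) * Real.exp (-(m * b * |v| ^ α)))) +
          5 * α * a * D₂ * (|u| ^ (α - 1) * |u| ^ (α / 2) * Real.exp (-(m * a * |u| ^ α)) *
            (|v| ^ (α / 2) * Real.exp (-(m * b * |v| ^ α)))) := by rw [hexp]; ring
    _ ≤ 2 * α * D₁ * (M₁ * M₂ / X) + 5 * α * a * D₂ * (M₃ * M₄ / X) := by gcongr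
    _ ≤ 2 * α * (D₁ + D₂) * (M₁ * M₂ / X) + 5 * α * a * (D₁ + D₂) * (M₃ * M₄ / X) := by
      gcongr <;> linarith
    _ = _ := by ring

/-! ### Fourier inversion for test functions -/

section testFunctions

open scoped FourierTransform ContDiff

/-- A test function as a superposition of characters, with the standard bounds on the weight. -/
lemma exists_fourier_repr {χ : ℝ → ℂ} (hc : HasCompactSupport χ) (hs : ContDiff ℝ ∞ χ) :
    ∃ h : ℝ → ℂ, Integrable h ∧
      (∀ x, χ x = ∫ u : ℝ, Complex.exp (Complex.I * ((2 * Real.pi * u * x : ℝ) : ℂ)) * h u) ∧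
      (∀ u, ‖h u‖ ≤ ∫ x, ‖χ x‖) ∧ ∀ u, 2 * Real.pi * |u| * ‖h u‖ ≤ ∫ x, ‖deriv χ x‖ := by
  set s : SchwartzMap ℝ ℂ := hc.toSchwartzMap hs with hs'
  have hsc : (s : ℝ → ℂ) = χ := rfl
  have hnorm : ∀ (ψ : ℝ → ℂ) u, ‖𝓕 ψ u‖ ≤ ∫ x, ‖ψ x‖ := fun ψ u ↦
    VectorFourier.norm_fourierIntegral_le_integral_norm Real.fourierChar volume _ ψ u
  have hF : Integrable (𝓕 χ) := by
    rw [← hsc, ← SchwartzMap.fourier_coe]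
    exact (𝓕 s).integrable
  have hχ : Integrable χ := s.integrable
  have hd : Integrable (deriv χ) :=
    (hs.continuous_deriv (by norm_num)).integrable_of_hasCompactSupport hc.deriv
  refine ⟨𝓕 χ, hF, fun x ↦ ?_, hnorm χ, fun u ↦ ?_⟩
  · rw [← congr_fun (hs.continuous.fourierInv_fourier_eq hχ hF) x, Real.fourierInv_eq']
    congr with u
    rw [smul_eq_mul]
    congr 2
    simp
    ring
  · have h1 := congr_fun (Real.fourier_deriv hχ (hs.differentiable (by norm_num)) hd) u
    refine le_trans (le_of_eq ?_) (hnorm (deriv χ) u)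
    rw [h1, norm_smul]
    simp [abs_of_pos Real.pi_pos]

section fubini
variable {Ω : Type*} [MeasurableSpace Ω] {P : Measure Ω}

lemma integrable_prod_exp {X : Ω → ℂ} {Z : Ω → ℝ} (hX : Integrable X P) (hZ : AEMeasurable Z P)
    {h : ℝ → ℂ} (hh : Integrable h) :
    Integrable (fun p : Ω × ℝ ↦ X p.1 *
      (Complex.exp (Complex.I * ((2 * Real.pi * p.2 * Z p.1 : ℝ) : ℂ)) * h p.2)) (P.prod volume) := by
  have h1 := hX.mul_prod hh
  have h2 : AEMeasurable (fun p : Ω × ℝ ↦ Z p.1) (P.prod volume) := hZ.comp_fst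
  have h3 : AEStronglyMeasurable (fun p : Ω × ℝ ↦
      Complex.exp (Complex.I * ((2 * Real.pi * p.2 * Z p.1 : ℝ) : ℂ))) (P.prod volume) :=
    AEMeasurable.aestronglyMeasurable (by fun_prop)
  refine (h1.bdd_mul h3 (c := 1) (ae_of_all _ fun p ↦ (norm_exp_I_mul_ofReal _).le)).congr
    (ae_of_all _ fun p ↦ ?_)
  simp only
  ring

lemma integrable_mul_integral_exp [SFinite P] {X : Ω → ℂ} {Z : Ω → ℝ} (hX : Integrable X P)
    (hZ : AEMeasurable Z P) {h : ℝ → ℂ} (hh : Integrable h) :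
    Integrable (fun u : ℝ ↦ h u *
      ∫ w, X w * Complex.exp (Complex.I * ((2 * Real.pi * u * Z w : ℝ) : ℂ)) ∂P) := by
  refine (integrable_prod_exp hX hZ hh).integral_prod_right.congr (ae_of_all _ fun u ↦ ?_)
  simp only
  rw [← integral_const_mul]
  congr with w
  ring

lemma integral_mul_fourier_repr [SFinite P] {X : Ω → ℂ} {Z : Ω → ℝ} (hX : Integrable X P)
    (hZ : AEMeasurable Z P) {h : ℝ → ℂ} (hh : Integrable h) {χ : ℝ → ℂ}
    (hχ : ∀ x, χ x = ∫ u : ℝ, Complex.exp (Complex.I * ((2 * Real.pi * u * x : ℝ) : ℂ)) * h u) :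
    ∫ w, X w * χ (Z w) ∂P = ∫ u : ℝ, h u *
      ∫ w, X w * Complex.exp (Complex.I * ((2 * Real.pi * u * Z w : ℝ) : ℂ)) ∂P := by
  simp_rw [hχ, ← integral_const_mul]
  rw [integral_integral_swap (integrable_prod_exp hX hZ hh)]
  congr with u
  congr with w
  ring

end fubini

lemma integral_univ_one_div_one_add_sq : ∫ x : ℝ, 1 / (1 + x ^ 2) = Real.pi := by
  simp

lemma integrable_one_div_one_add_sq : Integrable fun x : ℝ ↦ 1 / (1 + x ^ 2) := by
  simpa using integrable_inv_one_add_sq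

lemma div_one_add_two_pi_sq_le {B : ℝ} (hB : 0 ≤ B) (v : ℝ) :
    B / (1 + (2 * Real.pi * v) ^ 2) ≤ B * (1 / (1 + v ^ 2)) := by
  rw [mul_one_div]
  have : 1 ≤ (2 * Real.pi) ^ 2 := one_le_pow₀ (by linarith [Real.pi_gt_three])
  rw [mul_pow]
  gcongr
  exact le_mul_of_one_le_left (sq_nonneg v) this

/-- By Fourier inversion and Fubini, the pairing is the integral of the transform of `χ` against the
characteristic function. The former is at most `‖χ‖₁` and the latter has total mass at most `πM`. -/
lemma norm_integral_exp_le {ν : Measure ℝ} [IsProbabilityMeasure ν] {M : ℝ} (hM : 0 ≤ M)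
    (hν : ∀ t, ‖charFun ν t‖ ≤ M / (1 + t ^ 2)) {χ : ℝ → ℂ} (hc : HasCompactSupport χ)
    (hs : ContDiff ℝ ∞ χ) : ‖∫ x, χ x ∂ν‖ ≤ Real.pi * M * ∫ x, ‖χ x‖ := by
  obtain ⟨h, hh, hχ, hb, -⟩ := exists_fourier_repr hc hs
  have h1 := integral_mul_fourier_repr (P := ν) (X := fun _ ↦ 1) (integrable_const _)
    (Z := fun x ↦ x) (by fun_prop) hh hχ
  simp only [one_mul] at h1
  have h0 : 0 ≤ ∫ x, ‖χ x‖ := integral_nonneg fun _ ↦ norm_nonneg _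
  calc ‖∫ x, χ x ∂ν‖ ≤ ∫ v : ℝ, (∫ x, ‖χ x‖) * (M * (1 / (1 + v ^ 2))) := by
        rw [h1]
        refine norm_integral_le_of_norm_le
          ((integrable_one_div_one_add_sq.const_mul M).const_mul _) (ae_of_all _ fun v ↦ ?_)
        rw [norm_mul]
        refine mul_le_mul (hb v) ?_ (norm_nonneg _) h0
        refine le_trans ?_ (div_one_add_two_pi_sq_le hM v)
        refine le_trans (le_of_eq ?_) (hν _)
        rw [charFun_apply_real]
        congr 2 with x
        push_cast
        ring_nf
    _ = _ := by
        rw [integral_const_mul, integral_const_mul, integral_univ_one_div_one_add_sq]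
        ring

/-- The origin of the logarithm: `min(T, 1/|u|)` integrates over `|u| ≤ 1` to order `log T`. An
explicit majorant is returned for use in later norm estimates. -/
lemma integral_norm_div_one_add_sq_le {h : ℝ → ℂ} {T : ℝ} (hT : 1 ≤ T)
    (h1 : ∀ u, ‖h u‖ ≤ T) (h2 : ∀ u, |u| * ‖h u‖ ≤ 1) :
    ∃ m : ℝ → ℝ, Integrable m ∧ (∀ u, ‖h u‖ * (1 / (1 + u ^ 2)) ≤ m u) ∧
      ∫ u, m u ≤ 9 * Real.log (1 + T) := by
  have hT0 : 0 < T := by linarith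
  -- Adding `‖h‖ ≤ T` to `T` times `|u| ‖h‖ ≤ 1` gives `(1 + T|u|) ‖h‖ ≤ 2T`; this form has an
  -- elementary primitive.
  set F : ℝ → ℝ := (Set.Iic 1).indicator fun r ↦ 2 * T / (1 + T * r) with hF
  have hi : Integrable fun u : ℝ ↦ F |u| := by
    have : (fun u : ℝ ↦ F |u|) = (Set.Icc (-1) 1).indicator fun u ↦ 2 * T / (1 + T * |u|) := by
      ext u
      simp only [hF, Set.indicator, Set.mem_Iic, Set.mem_Icc, abs_le]
    rw [this, integrable_indicator_iff measurableSet_Icc]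
    refine ContinuousOn.integrableOn_Icc (ContinuousOn.div (by fun_prop) (by fun_prop) ?_)
    intro u _
    positivity
  refine ⟨fun u ↦ F |u| + 1 / (1 + u ^ 2), hi.add integrable_one_div_one_add_sq, fun u ↦ ?_, ?_⟩
  · have hu : 0 ≤ ‖h u‖ := norm_nonneg _
    have hle : 1 / (1 + u ^ 2) ≤ 1 := by
      rw [div_le_one (by positivity)]; nlinarith [sq_nonneg u]
    have hpos : 0 ≤ 1 / (1 + u ^ 2) := by positivity
    rcases le_or_gt |u| 1 with hu1 | hu1
    · have e : F |u| = 2 * T / (1 + T * |u|) := Set.indicator_of_mem (by simpa using hu1) _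
      show _ ≤ F |u| + _
      rw [e]
      have : ‖h u‖ ≤ 2 * T / (1 + T * |u|) := by
        rw [le_div_iff₀ (by positivity)]
        nlinarith [h1 u, h2 u]
      have : ‖h u‖ * (1 / (1 + u ^ 2)) ≤ ‖h u‖ := mul_le_of_le_one_right hu hle
      linarith
    · have e : F |u| = 0 := Set.indicator_of_notMem (by simpa using hu1) _
      show _ ≤ F |u| + _
      rw [e, zero_add]
      refine mul_le_of_le_one_left hpos ?_
      nlinarith [h2 u]
  · rw [integral_add hi integrable_one_div_one_add_sq, integral_univ_one_div_one_add_sq,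
      integral_comp_abs (f := F), hF, setIntegral_indicator measurableSet_Iic]
    have e1 : Set.Ioi (0 : ℝ) ∩ Set.Iic 1 = Set.Ioc 0 1 := rfl
    rw [e1, ← intervalIntegral.integral_of_le zero_le_one]
    have hderiv : ∀ r ∈ Set.uIcc (0 : ℝ) 1,
        HasDerivAt (fun r ↦ 2 * Real.log (1 + T * r)) (2 * T / (1 + T * r)) r := by
      intro r hr
      rw [Set.uIcc_of_le zero_le_one] at hr
      have hpos : 0 < 1 + T * r := by have := mul_nonneg hT0.le hr.1; linarith
      have hlin : HasDerivAt (fun r ↦ 1 + T * r) T r := by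
        simpa using ((hasDerivAt_id r).const_mul T).const_add 1
      convert! (hlin.log hpos.ne').const_mul 2 using 1
      ring
    rw [intervalIntegral.integral_eq_sub_of_hasDerivAt hderiv]
    -- The total is `4 log(1+T) + π`, and `π < 5 log 2 ≤ 5 log(1+T)`.
    · have l1 : Real.log 2 ≤ Real.log (1 + T) := Real.log_le_log (by norm_num) (by linarith)
      have l2 := Real.log_two_gt_d9
      have l3 := Real.pi_lt_d2
      simp only [mul_one, mul_zero, add_zero, Real.log_one]
      linarith
    · refine ContinuousOn.intervalIntegrable (ContinuousOn.div (by fun_prop) (by fun_prop) ?_)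
      intro r hr
      rw [Set.uIcc_of_le zero_le_one] at hr
      have := mul_nonneg hT0.le hr.1
      positivity

/-- Smooth approximation of the indicator of `(a, ∞)`. -/
noncomputable def smoothStep (a δ : ℝ) (x : ℝ) : ℝ := Real.smoothTransition ((x - a) / δ)

/-! ### Smooth approximations of `1_{(a,t]}` -/

section smoothStep
variable {a t δ : ℝ}

lemma contDiff_smoothStep (a δ : ℝ) : ContDiff ℝ ∞ (smoothStep a δ) :=
  Real.smoothTransition.contDiff.comp ((contDiff_id.sub contDiff_const).div_const δ)

lemma smoothStep_of_le (hδ : 0 < δ) {x : ℝ} (hx : x ≤ a) : smoothStep a δ x = 0 :=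
  Real.smoothTransition.zero_of_nonpos (div_nonpos_of_nonpos_of_nonneg (by linarith) hδ.le)

lemma smoothStep_of_ge (hδ : 0 < δ) {x : ℝ} (hx : a + δ ≤ x) : smoothStep a δ x = 1 :=
  Real.smoothTransition.one_of_one_le ((one_le_div hδ).2 (by linarith))

lemma smoothStep_nonneg (x : ℝ) : 0 ≤ smoothStep a δ x := Real.smoothTransition.nonneg _

lemma smoothStep_le_one (x : ℝ) : smoothStep a δ x ≤ 1 := Real.smoothTransition.le_one _

lemma monotone_smoothStep (hδ : 0 < δ) : Monotone (smoothStep a δ) := fun x y hxy ↦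
  Real.smoothTransition.monotone (by gcongr)

lemma antitone_smoothStep_left (hδ : 0 < δ) (h : a ≤ t) (x : ℝ) :
    smoothStep t δ x ≤ smoothStep a δ x :=
  Real.smoothTransition.monotone (by gcongr)

lemma hasCompactSupport_deriv_smoothStep (hδ : 0 < δ) :
    HasCompactSupport (deriv (smoothStep a δ)) := by
  refine HasCompactSupport.intro (K := Set.Icc a (a + δ)) isCompact_Icc fun x hx ↦ ?_
  rw [Set.mem_Icc, not_and_or, not_le, not_le] at hx
  rcases hx with hx | hx
  · have : smoothStep a δ =ᶠ[nhds x] fun _ ↦ 0 := by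
      filter_upwards [Iio_mem_nhds hx] with y hy using smoothStep_of_le hδ (le_of_lt hy)
    rw [this.deriv_eq, deriv_const]
  · have : smoothStep a δ =ᶠ[nhds x] fun _ ↦ 1 := by
      filter_upwards [Ioi_mem_nhds hx] with y hy using smoothStep_of_ge hδ (le_of_lt hy)
    rw [this.deriv_eq, deriv_const]

lemma integrable_deriv_smoothStep (hδ : 0 < δ) : Integrable (deriv (smoothStep a δ)) :=
  ((contDiff_smoothStep a δ).continuous_deriv (by norm_num)).integrable_of_hasCompactSupport
    (hasCompactSupport_deriv_smoothStep hδ)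

lemma integral_abs_deriv_smoothStep (hδ : 0 < δ) : ∫ x, |deriv (smoothStep a δ) x| = 1 := by
  simp_rw [abs_of_nonneg ((monotone_smoothStep hδ).deriv_nonneg)]
  have hd : ∀ x, HasDerivAt (smoothStep a δ) (deriv (smoothStep a δ) x) x := fun x ↦
    ((contDiff_smoothStep a δ).differentiable (by norm_num) x).hasDerivAt
  rw [integral_of_hasDerivAt_of_tendsto hd (integrable_deriv_smoothStep hδ) (m := 0) (n := 1),
    sub_zero]
  · refine tendsto_const_nhds.congr' ?_
    filter_upwards [Filter.eventually_le_atBot a] with x hx using (smoothStep_of_le hδ hx).symm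
  · refine tendsto_const_nhds.congr' ?_
    filter_upwards [Filter.eventually_ge_atTop (a + δ)] with x hx
      using (smoothStep_of_ge hδ hx).symm

/-- A smooth function that is `1` on `[a + δ, t]` and vanishes off `(a, t + δ)`. -/
noncomputable def smoothBump (a t δ : ℝ) (x : ℝ) : ℝ := smoothStep a δ x - smoothStep t δ x

lemma contDiff_smoothBump (a t δ : ℝ) : ContDiff ℝ ∞ (smoothBump a t δ) :=
  (contDiff_smoothStep a δ).sub (contDiff_smoothStep t δ)

lemma smoothBump_nonneg (hδ : 0 < δ) (h : a ≤ t) (x : ℝ) : 0 ≤ smoothBump a t δ x :=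
  sub_nonneg.2 (antitone_smoothStep_left hδ h x)

lemma smoothBump_le_one (x : ℝ) : smoothBump a t δ x ≤ 1 := by
  have h1 := smoothStep_le_one (a := a) (δ := δ) x
  have h2 := smoothStep_nonneg (a := t) (δ := δ) x
  rw [smoothBump]; linarith

lemma smoothBump_of_notMem (hδ : 0 < δ) (h : a ≤ t) {x : ℝ} (hx : x ∉ Set.Icc a (t + δ)) :
    smoothBump a t δ x = 0 := by
  rw [Set.mem_Icc, not_and_or, not_le, not_le] at hx
  rcases hx with hx | hx
  · rw [smoothBump, smoothStep_of_le hδ hx.le, smoothStep_of_le hδ (hx.le.trans h), sub_zero]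
  · rw [smoothBump, smoothStep_of_ge hδ hx.le, smoothStep_of_ge hδ (by linarith), sub_self]

lemma hasCompactSupport_smoothBump (hδ : 0 < δ) (h : a ≤ t) :
    HasCompactSupport (smoothBump a t δ) :=
  HasCompactSupport.intro isCompact_Icc fun _ hx ↦ smoothBump_of_notMem hδ h hx

lemma integral_smoothBump_le (hδ : 0 < δ) (h : a ≤ t) :
    ∫ x, smoothBump a t δ x ≤ t + δ - a := by
  calc ∫ x, smoothBump a t δ x ≤ ∫ x, (Set.Icc a (t + δ)).indicator (fun _ ↦ (1 : ℝ)) x := by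
        refine integral_mono ((contDiff_smoothBump a t δ).continuous.integrable_of_hasCompactSupport
          (hasCompactSupport_smoothBump hδ h)) ?_ fun x ↦ ?_
        · rw [integrable_indicator_iff measurableSet_Icc]
          simp
        · by_cases hx : x ∈ Set.Icc a (t + δ)
          · rw [Set.indicator_of_mem hx]; exact smoothBump_le_one x
          · rw [Set.indicator_of_notMem hx, smoothBump_of_notMem hδ h hx]
    _ = _ := by
        rw [integral_indicator measurableSet_Icc]
        simp only [integral_const, measureReal_restrict_apply_univ, smul_eq_mul, mul_one]
        rw [Real.volume_real_Icc_of_le (by linarith)]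

lemma integral_abs_deriv_smoothBump_le (hδ : 0 < δ) :
    ∫ x, |deriv (smoothBump a t δ) x| ≤ 2 := by
  have hd : ∀ x, deriv (smoothBump a t δ) x =
      deriv (smoothStep a δ) x - deriv (smoothStep t δ) x := fun x ↦
    deriv_fun_sub ((contDiff_smoothStep a δ).differentiable (by norm_num) x)
      ((contDiff_smoothStep t δ).differentiable (by norm_num) x)
  have i1 := integrable_deriv_smoothStep (a := a) hδ
  have i2 := integrable_deriv_smoothStep (a := t) hδ
  calc _ ≤ ∫ x, (|deriv (smoothStep a δ) x| + |deriv (smoothStep t δ) x|) := by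
        refine integral_mono ?_ (i1.abs.add i2.abs) fun x ↦ ?_
        · simp_rw [hd]; exact (i1.sub i2).abs
        · simp only [hd]; exact abs_sub _ _
    _ = 2 := by
        rw [integral_add i1.abs i2.abs, integral_abs_deriv_smoothStep hδ,
          integral_abs_deriv_smoothStep hδ]
        norm_num

lemma tendsto_smoothBump (h : a ≤ t) (x : ℝ) :
    Filter.Tendsto (fun n : ℕ ↦ smoothBump a t (1 / ((n : ℝ) + 1)) x) Filter.atTop
      (nhds ((Set.Ioc a t).indicator 1 x)) := by
  have key : ∀ c : ℝ, Filter.Tendsto (fun n : ℕ ↦ smoothStep c (1 / ((n : ℝ) + 1)) x) Filter.atTop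
      (nhds ((Set.Ioi c).indicator 1 x)) := by
    intro c
    refine tendsto_const_nhds.congr' ?_
    rcases le_or_gt x c with hx | hx
    · filter_upwards with n
      rw [smoothStep_of_le (by positivity) hx, Set.indicator_of_notMem (by simpa using hx)]
    · obtain ⟨N, hN⟩ := exists_nat_one_div_lt (sub_pos.2 hx)
      filter_upwards [Filter.eventually_ge_atTop N] with n hn
      have : 1 / ((n : ℝ) + 1) ≤ 1 / ((N : ℝ) + 1) := by gcongr
      rw [smoothStep_of_ge (by positivity) (by linarith), Set.indicator_of_mem (by simpa using hx)]
      simp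
  have := (key a).sub (key t)
  convert! this using 2
  simp only [Set.indicator, Set.mem_Ioc, Set.mem_Ioi, Pi.one_apply]
  split_ifs <;> grind

end smoothStep

end testFunctions

/-! ### Bounded density from decay of the characteristic function -/

section density
variable {ν : Measure ℝ} [IsProbabilityMeasure ν]

/-- A probability measure with Lipschitz distribution function is dominated by Lebesgue measure. -/
lemma le_smul_volume_of_measureReal_Ioc_le {c : NNReal}
    (h : ∀ a t : ℝ, a ≤ t → ν.real (Set.Ioc a t) ≤ c * (t - a)) : ν ≤ c • volume := by
  have hcdf : ∀ a t : ℝ, a ≤ t → cdf ν t - cdf ν a ≤ c * (t - a) := by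
    intro a t hat
    have h1 := congr_arg (fun m ↦ m (Set.Ioc a t)) (measure_cdf ν)
    simp only [StieltjesFunction.measure_Ioc] at h1
    have h2 := h a t hat
    rwa [measureReal_def, ← h1, ENNReal.toReal_ofReal (sub_nonneg.2 (monotone_cdf ν hat))] at h2
  -- The Lipschitz bound makes `c x - F(x)` monotone, so its Stieltjes measure is exactly what must
  -- be added to `ν` to obtain `c` times Lebesgue measure.
  let g : StieltjesFunction ℝ :=
    { toFun := fun x ↦ c * x - cdf ν x
      mono' := fun a t hat ↦ by
        have := hcdf a t hat
        simp only
        linarith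
      right_continuous' := fun x ↦
        (Continuous.continuousWithinAt (by fun_prop)).sub ((cdf ν).right_continuous x) }
  have hsum : cdf ν + g = c • StieltjesFunction.id := by
    ext x
    show cdf ν x + (c * x - cdf ν x) = c * x
    ring
  have h1 := StieltjesFunction.measure_add (cdf ν) g
  rw [hsum, StieltjesFunction.measure_smul, ← Real.volume_eq_stieltjes_id, measure_cdf] at h1
  rw [h1]
  exact Measure.le_add_right le_rfl

lemma smoothBump_integral_le_of_charFun {M : ℝ} (hM : 0 ≤ M)
    (hν : ∀ t, ‖charFun ν t‖ ≤ M / (1 + t ^ 2)) {a t δ : ℝ} (hδ : 0 < δ) (hat : a ≤ t) :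
    ∫ x, smoothBump a t δ x ∂ν ≤ Real.pi * M * (t + δ - a) := by
  have h1 := norm_integral_exp_le hM hν (χ := fun x ↦ (smoothBump a t δ x : ℂ))
    ((hasCompactSupport_smoothBump hδ hat).comp_left Complex.ofReal_zero)
    (Complex.ofRealCLM.contDiff.comp (contDiff_smoothBump a t δ))
  rw [integral_complex_ofReal, Complex.norm_real] at h1
  simp only [Complex.norm_real, Real.norm_of_nonneg (smoothBump_nonneg hδ hat _)] at h1
  refine (Real.le_norm_self _).trans (h1.trans ?_)
  have := Real.pi_pos
  gcongr
  exact integral_smoothBump_le hδ hat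

lemma le_smul_volume_of_charFun {M : NNReal} (hν : ∀ t, ‖charFun ν t‖ ≤ M / (1 + t ^ 2)) :
    ν ≤ (NNReal.pi * M) • volume := by
  refine le_smul_volume_of_measureReal_Ioc_le fun a t hat ↦ ?_
  have h1 : Filter.Tendsto (fun n : ℕ ↦ ∫ x, smoothBump a t (1 / ((n : ℝ) + 1)) x ∂ν) Filter.atTop
      (nhds (∫ x, (Set.Ioc a t).indicator 1 x ∂ν)) := by
    refine tendsto_integral_of_dominated_convergence (fun _ ↦ 1)
      (fun n ↦ (contDiff_smoothBump _ _ _).continuous.aestronglyMeasurable) (integrable_const _)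
      (fun n ↦ ae_of_all _ fun x ↦ ?_) (ae_of_all _ fun x ↦ tendsto_smoothBump hat x)
    rw [Real.norm_of_nonneg (smoothBump_nonneg (by positivity) hat x)]
    exact smoothBump_le_one x
  rw [integral_indicator_one measurableSet_Ioc] at h1
  have h2 : Filter.Tendsto (fun n : ℕ ↦ Real.pi * M * (t + 1 / ((n : ℝ) + 1) - a)) Filter.atTop
      (nhds (Real.pi * M * (t + 0 - a))) :=
    ((tendsto_one_div_add_atTop_nhds_zero_nat.const_add t).sub_const a).const_mul _
  rw [add_zero] at h2
  refine (le_of_tendsto_of_tendsto' h1 h2 fun n ↦ ?_).trans_eq (by simp)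
  exact smoothBump_integral_le_of_charFun M.2 hν (by positivity) hat

end density

/-! ### Covariance of `ξ 1_{a<ξ≤t}` with `L(η)` -/

section key
variable {Ω : Type*} [MeasurableSpace Ω] {P : Measure Ω} {ξ η : Ω → ℝ} {L : ℝ → ℝ} {c : NNReal}

lemma integrable_comp_of_map_le (hη : AEMeasurable η P) (hc : P.map η ≤ c • volume)
    (hL : Integrable L) : Integrable (fun ω ↦ L (η ω)) P := by
  have h1 : Integrable L (P.map η) := hL.smul_measure_nnreal.mono_measure hc
  exact (integrable_map_measure h1.aestronglyMeasurable hη).1 h1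

lemma integral_abs_comp_le_of_map_le (hη : AEMeasurable η P) (hc : P.map η ≤ c • volume)
    (hL : Integrable L) : ∫ ω, |L (η ω)| ∂P ≤ c * ∫ y, |L y| := by
  have h1 : Integrable L (P.map η) := hL.smul_measure_nnreal.mono_measure hc
  rw [← integral_map (f := fun y ↦ |L y|) hη h1.abs.aestronglyMeasurable]
  refine (integral_mono_measure hc (ae_of_all _ fun y ↦ abs_nonneg _)
    hL.abs.smul_measure_nnreal).trans_eq ?_
  rw [integral_smul_nnreal_measure]
  rfl

variable [IsProbabilityMeasure P]

open scoped ContDiff in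
-- Only the bump is Fourier-transformed, not `x` times the bump: the factor `ξ` is already in
-- `expCov`. The transform then has height at most `t` and total variation bound `|u| ‖h u‖ ≤ 1`, so
-- the loss in `t` is logarithmic.
lemma abs_cov_smoothBump_le {B a t δ : ℝ} (hB : 0 ≤ B) (hξ : Integrable ξ P)
    (hη : AEMeasurable η P)
    (hR : ∀ u v, ‖expCov P ξ η u v‖ ≤ B / ((1 + u ^ 2) * (1 + v ^ 2)))
    (ha : 1 ≤ a) (hat : a ≤ t) (hδ : 0 < δ) (hδ' : δ ≤ 1)
    (hc : HasCompactSupport L) (hs : ContDiff ℝ ∞ L) :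
    |(∫ w, ξ w * smoothBump a t δ (ξ w) * L (η w) ∂P) -
      (∫ w, ξ w * smoothBump a t δ (ξ w) ∂P) * ∫ w, L (η w) ∂P| ≤
      9 * Real.pi * B * Real.log (1 + t) * ∫ y, |L y| := by
  have hξm := hξ.aemeasurable
  set χ : ℝ → ℂ := fun x ↦ (smoothBump a t δ x : ℂ) with hχ
  set Λ : ℝ → ℂ := fun y ↦ (L y : ℂ) with hΛ
  have hχs : ContDiff ℝ ∞ χ := Complex.ofRealCLM.contDiff.comp (contDiff_smoothBump a t δ)
  have hΛs : ContDiff ℝ ∞ Λ := Complex.ofRealCLM.contDiff.comp hs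
  have hχc : HasCompactSupport χ :=
    (hasCompactSupport_smoothBump hδ hat).comp_left Complex.ofReal_zero
  have hΛc : HasCompactSupport Λ := hc.comp_left Complex.ofReal_zero
  obtain ⟨h, hh, hχr, hb₁, hb₂⟩ := exists_fourier_repr hχc hχs
  obtain ⟨k, hk, hΛr, hb₃, -⟩ := exists_fourier_repr hΛc hΛs
  -- The bump has mass at most `t + δ - a`, and `δ ≤ 1 ≤ a`.
  have hT : ∀ u, ‖h u‖ ≤ t := fun u ↦ by
    refine (hb₁ u).trans ?_
    simp only [hχ, Complex.norm_real, Real.norm_of_nonneg (smoothBump_nonneg hδ hat _)]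
    linarith [integral_smoothBump_le hδ hat]
  have hu1 : ∀ u, |u| * ‖h u‖ ≤ 1 := fun u ↦ by
    have h1 : ∀ x, deriv χ x = ((deriv (smoothBump a t δ) x : ℝ) : ℂ) := fun x ↦
      (((contDiff_smoothBump a t δ).differentiable (by norm_num) x).hasDerivAt.ofReal_comp).deriv
    have h2 := hb₂ u
    simp only [h1, Complex.norm_real, Real.norm_eq_abs] at h2
    have h3 := h2.trans (integral_abs_deriv_smoothBump_le hδ)
    have h4 : 0 ≤ |u| * ‖h u‖ := by positivity
    nlinarith [Real.pi_gt_three]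
  have hL1 : ∀ v, ‖k v‖ ≤ ∫ y, |L y| := fun v ↦ by
    simpa only [hΛ, Complex.norm_real, Real.norm_eq_abs] using hb₃ v
  obtain ⟨CL, hCL⟩ := hΛs.continuous.bounded_above_of_compact_support hΛc
  have hξc : Integrable (fun w ↦ (ξ w : ℂ)) P := hξ.ofReal
  have hΛm : AEStronglyMeasurable (fun w ↦ Λ (η w)) P :=
    (hΛs.continuous.measurable.comp_aemeasurable hη).aestronglyMeasurable
  have hξΛ : Integrable (fun w ↦ (ξ w : ℂ) * Λ (η w)) P :=
    hξc.mul_bdd (c := CL) hΛm (ae_of_all _ fun w ↦ hCL _)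
  have hξe : ∀ u : ℝ, Integrable
      (fun w ↦ (ξ w : ℂ) * Complex.exp (Complex.I * ((2 * Real.pi * u * ξ w : ℝ) : ℂ))) P := fun u ↦
    hξc.mul_bdd (c := 1) (AEMeasurable.aestronglyMeasurable (by fun_prop))
      (ae_of_all _ fun w ↦ (norm_exp_I_mul_ofReal _).le)
  have E1 := integral_mul_fourier_repr hξΛ hξm hh hχr
  have E2 := integral_mul_fourier_repr hξc hξm hh hχr
  have E3 := integral_mul_fourier_repr (P := P) (X := fun _ ↦ 1) (integrable_const _) hη hk hΛr
  simp only [one_mul] at E3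
  have E4 : ∀ u : ℝ,
      ∫ w, ξ w * Λ (η w) * Complex.exp (Complex.I * ((2 * Real.pi * u * ξ w : ℝ) : ℂ)) ∂P =
      ∫ v : ℝ, k v * ∫ w, (ξ w : ℂ) * Complex.exp
        (Complex.I * ((2 * Real.pi * u * ξ w + 2 * Real.pi * v * η w : ℝ) : ℂ)) ∂P := fun u ↦ by
    have := integral_mul_fourier_repr (hξe u) hη hk hΛr
    calc _ = _ := by congr with w; ring
      _ = _ := this
      _ = _ := by
        congr with v
        congr with w
        rw [mul_assoc, ← Complex.exp_add]
        push_cast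
        ring_nf
  have I4 : ∀ u : ℝ, Integrable fun v : ℝ ↦ k v * ∫ w, (ξ w : ℂ) * Complex.exp
        (Complex.I * ((2 * Real.pi * u * ξ w + 2 * Real.pi * v * η w : ℝ) : ℂ)) ∂P := fun u ↦ by
    refine (integrable_mul_integral_exp (hξe u) hη hk).congr (ae_of_all _ fun v ↦ ?_)
    simp only
    congr with w
    rw [mul_assoc, ← Complex.exp_add]
    push_cast
    ring_nf
  have I3 : Integrable fun v : ℝ ↦ k v *
      ∫ w, Complex.exp (Complex.I * ((2 * Real.pi * v * η w : ℝ) : ℂ)) ∂P := by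
    simpa only [one_mul] using
      integrable_mul_integral_exp (P := P) (X := fun _ ↦ 1) (integrable_const _) hη hk
  have E5 : (∫ w, ξ w * Λ (η w) * χ (ξ w) ∂P) - (∫ w, ξ w * χ (ξ w) ∂P) * ∫ w, Λ (η w) ∂P =
      ∫ u : ℝ, h u * ∫ v : ℝ, k v *
        expCov P ξ η (2 * Real.pi * u) (2 * Real.pi * v) := by
    rw [E1, E2, E3, ← integral_mul_const, ← integral_sub (integrable_mul_integral_exp hξΛ hξm hh)
      ((integrable_mul_integral_exp hξc hξm hh).mul_const _)]
    congr with u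
    rw [mul_assoc (h u), ← mul_sub, E4, ← integral_const_mul, ← integral_sub (I4 u) (I3.const_mul _)]
    congr with v
    rw [expCov]
    ring
  obtain ⟨m, hm, hmle, hmint⟩ := integral_norm_div_one_add_sq_le (ha.trans hat) hT hu1
  have hL0 : 0 ≤ ∫ y, |L y| := integral_nonneg fun _ ↦ abs_nonneg _
  have hinner : ∀ u : ℝ, ‖∫ v : ℝ, k v * expCov P ξ η (2 * Real.pi * u) (2 * Real.pi * v)‖ ≤
      (∫ y, |L y|) * (Real.pi * B) * (1 / (1 + u ^ 2)) := fun u ↦ by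
    calc _ ≤ ∫ v : ℝ, (∫ y, |L y|) * (B * (1 / (1 + u ^ 2)) * (1 / (1 + v ^ 2))) := by
          refine norm_integral_le_of_norm_le
            ((integrable_one_div_one_add_sq.const_mul _).const_mul _) (ae_of_all _ fun v ↦ ?_)
          rw [norm_mul]
          refine mul_le_mul (hL1 v) ?_ (norm_nonneg _) hL0
          refine (hR _ _).trans ?_
          rw [← div_div]
          refine (div_one_add_two_pi_sq_le (by positivity) v).trans ?_
          gcongr
          exact div_one_add_two_pi_sq_le hB u
      _ = _ := by
          rw [integral_const_mul, integral_const_mul, integral_univ_one_div_one_add_sq]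
          ring
  have E6 : (∫ w, ξ w * Λ (η w) * χ (ξ w) ∂P) - (∫ w, ξ w * χ (ξ w) ∂P) * ∫ w, Λ (η w) ∂P =
      (((∫ w, ξ w * smoothBump a t δ (ξ w) * L (η w) ∂P) -
      (∫ w, ξ w * smoothBump a t δ (ξ w) ∂P) * ∫ w, L (η w) ∂P : ℝ) : ℂ) := by
    push_cast
    simp only [← integral_complex_ofReal, hχ, hΛ]
    push_cast
    congr 2 with w
    ring
  rw [← Real.norm_eq_abs, ← Complex.norm_real, ← E6, E5]
  calc _ ≤ ∫ u : ℝ, (∫ y, |L y|) * (Real.pi * B) * m u := by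
        refine norm_integral_le_of_norm_le (hm.const_mul _) (ae_of_all _ fun u ↦ ?_)
        rw [norm_mul]
        calc _ ≤ ‖h u‖ * ((∫ y, |L y|) * (Real.pi * B) * (1 / (1 + u ^ 2))) := by
              gcongr; exact hinner u
          _ = (∫ y, |L y|) * (Real.pi * B) * (‖h u‖ * (1 / (1 + u ^ 2))) := by ring
          _ ≤ _ := by
              have := Real.pi_pos
              gcongr
              exact hmle u
    _ ≤ (∫ y, |L y|) * (Real.pi * B) * (9 * Real.log (1 + t)) := by
        rw [integral_const_mul]
        have := Real.pi_pos
        gcongr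
    _ = _ := by ring

open scoped ContDiff in
lemma abs_cov_indicator_le_of_contDiff {B a t : ℝ} (hB : 0 ≤ B) (hξ : Integrable ξ P)
    (hη : AEMeasurable η P)
    (hR : ∀ u v, ‖expCov P ξ η u v‖ ≤ B / ((1 + u ^ 2) * (1 + v ^ 2)))
    (ha : 1 ≤ a) (hat : a ≤ t) (hc : HasCompactSupport L) (hs : ContDiff ℝ ∞ L) :
    |(∫ w, ξ w * (Set.Ioc a t).indicator 1 (ξ w) * L (η w) ∂P) -
      (∫ w, ξ w * (Set.Ioc a t).indicator 1 (ξ w) ∂P) * ∫ w, L (η w) ∂P| ≤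
      9 * Real.pi * B * Real.log (1 + t) * ∫ y, |L y| := by
  have hξm := hξ.aemeasurable
  obtain ⟨CL, hCL⟩ := hs.continuous.bounded_above_of_compact_support hc
  have hbm : ∀ n : ℕ, AEMeasurable (fun w ↦ smoothBump a t (1 / ((n : ℝ) + 1)) (ξ w)) P := fun n ↦
    (contDiff_smoothBump _ _ _).continuous.measurable.comp_aemeasurable hξm
  have hLm : AEMeasurable (fun w ↦ L (η w)) P := hs.continuous.measurable.comp_aemeasurable hη
  have hbd : ∀ (n : ℕ) w, ‖smoothBump a t (1 / ((n : ℝ) + 1)) (ξ w)‖ ≤ 1 := fun n w ↦ by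
    rw [Real.norm_of_nonneg (smoothBump_nonneg (by positivity) hat _)]
    exact smoothBump_le_one _
  have hlim : ∀ w, Filter.Tendsto (fun n : ℕ ↦ ξ w * smoothBump a t (1 / ((n : ℝ) + 1)) (ξ w))
      Filter.atTop (nhds (ξ w * (Set.Ioc a t).indicator 1 (ξ w))) := fun w ↦
    (tendsto_smoothBump hat (ξ w)).const_mul _
  have h1 : Filter.Tendsto (fun n : ℕ ↦
      ∫ w, ξ w * smoothBump a t (1 / ((n : ℝ) + 1)) (ξ w) * L (η w) ∂P) Filter.atTop
      (nhds (∫ w, ξ w * (Set.Ioc a t).indicator 1 (ξ w) * L (η w) ∂P)) := by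
    refine tendsto_integral_of_dominated_convergence (fun w ↦ |ξ w| * CL)
      (fun n ↦ ((hξm.mul (hbm n)).mul hLm).aestronglyMeasurable)
      (hξ.abs.mul_const _) (fun n ↦ ae_of_all _ fun w ↦ ?_)
      (ae_of_all _ fun w ↦ (hlim w).mul_const _)
    rw [norm_mul, norm_mul]
    exact mul_le_mul (mul_le_of_le_one_right (norm_nonneg _) (hbd n w)) (hCL _) (norm_nonneg _)
      (abs_nonneg _)
  have h2 : Filter.Tendsto (fun n : ℕ ↦
      ∫ w, ξ w * smoothBump a t (1 / ((n : ℝ) + 1)) (ξ w) ∂P) Filter.atTop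
      (nhds (∫ w, ξ w * (Set.Ioc a t).indicator 1 (ξ w) ∂P)) := by
    refine tendsto_integral_of_dominated_convergence (fun w ↦ |ξ w|)
      (fun n ↦ (hξm.mul (hbm n)).aestronglyMeasurable)
      hξ.abs (fun n ↦ ae_of_all _ fun w ↦ ?_) (ae_of_all _ fun w ↦ hlim w)
    rw [norm_mul]
    exact mul_le_of_le_one_right (norm_nonneg _) (hbd n w)
  refine le_of_tendsto (h1.sub (h2.mul_const _)).abs (Filter.Eventually.of_forall fun n ↦ ?_)
  refine abs_cov_smoothBump_le hB hξ hη hR ha hat (by positivity) ?_ hc hs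
  rw [div_le_one (by positivity)]
  linarith [n.cast_nonneg (α := ℝ)]

/-- `L` is approximated in `L¹` by test functions. The truncated `ξ` is bounded by `t` and the law
of `η` by `c` times Lebesgue measure, so the error is a multiple of the approximation error and `c`
drops out in the limit. -/
lemma abs_cov_indicator_le {B a t : ℝ} (hB : 0 ≤ B) (hξ : Integrable ξ P)
    (hη : AEMeasurable η P) (hc : P.map η ≤ c • volume)
    (hR : ∀ u v, ‖expCov P ξ η u v‖ ≤ B / ((1 + u ^ 2) * (1 + v ^ 2)))
    (ha : 1 ≤ a) (hat : a ≤ t) (hL : Integrable L) :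
    |(∫ w, ξ w * (Set.Ioc a t).indicator 1 (ξ w) * L (η w) ∂P) -
      (∫ w, ξ w * (Set.Ioc a t).indicator 1 (ξ w) ∂P) * ∫ w, L (η w) ∂P| ≤
      9 * Real.pi * B * Real.log (1 + t) * ∫ y, |L y| := by
  have hξm := hξ.aemeasurable
  set X : Ω → ℝ := fun w ↦ ξ w * (Set.Ioc a t).indicator 1 (ξ w) with hX
  set K := 9 * Real.pi * B * Real.log (1 + t) with hK
  have hK0 : 0 ≤ K := by
    have := Real.pi_pos
    have := Real.log_nonneg (show 1 ≤ 1 + t by linarith)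
    positivity
  have hXm : AEMeasurable X P :=
    hξm.mul ((measurable_one.indicator measurableSet_Ioc).comp_aemeasurable hξm)
  have hXb : ∀ w, ‖X w‖ ≤ t := fun w ↦ by
    by_cases hw : ξ w ∈ Set.Ioc a t
    · simp only [hX, Set.indicator_of_mem hw, Pi.one_apply, mul_one]
      rw [Real.norm_of_nonneg (by linarith [hw.1])]
      exact hw.2
    · simp only [hX, Set.indicator_of_notMem hw, mul_zero, norm_zero]
      linarith
  have ht0 : 0 ≤ t := by linarith
  have approx : ∀ n : ℕ, |(∫ w, X w * L (η w) ∂P) - (∫ w, X w ∂P) * ∫ w, L (η w) ∂P| ≤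
      K * (∫ y, |L y|) + (K + 2 * t * c) * (1 / ((n : ℝ) + 1)) := by
    intro n
    have hε : 0 < 1 / ((n : ℝ) + 1) := by positivity
    set ε := 1 / ((n : ℝ) + 1)
    obtain ⟨G, hGc, hGs, hG⟩ :=
      (memLp_one_iff_integrable.2 hL).exist_eLpNorm_sub_le ENNReal.one_ne_top le_rfl hε
    have hGi : Integrable G := hGs.continuous.integrable_of_hasCompactSupport hGc
    have hd : ∫ y, |L y - G y| ≤ ε := by
      rw [eLpNorm_one_eq_lintegral_enorm, ← ofReal_integral_norm_eq_lintegral_enorm (hL.sub hGi),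
        ENNReal.ofReal_le_ofReal_iff hε.le] at hG
      exact hG
    have main := abs_cov_indicator_le_of_contDiff hB hξ hη hR ha hat hGc hGs
    have iL := integrable_comp_of_map_le hη hc hL
    have iG := integrable_comp_of_map_le hη hc hGi
    have iD : ∫ w, |L (η w) - G (η w)| ∂P ≤ c * ε :=
      (integral_abs_comp_le_of_map_le hη hc (hL.sub hGi)).trans (by simp only [Pi.sub_apply]; gcongr)
    have hGL : ∫ y, |G y| ≤ (∫ y, |L y|) + ε := by
      have : ∫ y, |G y| ≤ ∫ y, (|L y| + |L y - G y|) :=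
        integral_mono hGi.abs (hL.abs.add (hL.sub hGi).abs) fun y ↦ by
          have := abs_sub_abs_le_abs_sub (G y) (L y)
          rw [abs_sub_comm] at this
          simp only
          linarith
      rw [integral_add (g := fun y ↦ |L y - G y|) hL.abs (hL.sub hGi).abs] at this
      linarith
    have iXL := iL.bdd_mul (c := t) hXm.aestronglyMeasurable (ae_of_all _ hXb)
    have iXG := iG.bdd_mul (c := t) hXm.aestronglyMeasurable (ae_of_all _ hXb)
    have d1 : |(∫ w, X w * L (η w) ∂P) - ∫ w, X w * G (η w) ∂P| ≤ t * (c * ε) := by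
      rw [← integral_sub iXL iXG]
      refine le_trans ?_ (mul_le_mul_of_nonneg_left iD ht0)
      rw [← integral_const_mul, ← Real.norm_eq_abs]
      refine norm_integral_le_of_norm_le ((iL.sub iG).abs.const_mul t) (ae_of_all _ fun w ↦ ?_)
      rw [← mul_sub, norm_mul]
      exact mul_le_mul_of_nonneg_right (hXb w) (norm_nonneg _)
    have d2 : |(∫ w, X w ∂P) * (∫ w, L (η w) ∂P) - (∫ w, X w ∂P) * ∫ w, G (η w) ∂P| ≤
        t * (c * ε) := by
      rw [← mul_sub, abs_mul, ← integral_sub iL iG]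
      refine mul_le_mul ?_ ((abs_integral_le_integral_abs).trans iD) (abs_nonneg _) ht0
      simpa using norm_integral_le_of_norm_le_const (ae_of_all P hXb)
    have d3 : K * ∫ y, |G y| ≤ K * (∫ y, |L y|) + K * ε := by
      rw [← mul_add]; gcongr
    change |(∫ w, X w * G (η w) ∂P) - (∫ w, X w ∂P) * ∫ w, G (η w) ∂P| ≤ K * _ at main
    rw [abs_le] at *
    constructor <;> linarith
  have hlim : Filter.Tendsto
      (fun n : ℕ ↦ K * (∫ y, |L y|) + (K + 2 * t * c) * (1 / ((n : ℝ) + 1))) Filter.atTop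
      (nhds (K * (∫ y, |L y|) + (K + 2 * t * c) * 0)) :=
    (tendsto_one_div_add_atTop_nhds_zero_nat.const_mul _).const_add _
  rw [mul_zero, add_zero] at hlim
  exact ge_of_tendsto' hlim approx

end key

/-! ### Superlevel sets and the layer-cake passage -/

section layerCake
variable {β κ b : ℝ} {k : ℝ → ℝ}

/-- An antitone function tending to 0 at infinity is nonnegative. -/
lemma nonneg_of_antitoneOn_of_abs_le_rpow (hβ : β < 1) (hk : AntitoneOn k (Set.Ioi b))
    (hκ : ∀ x, b < x → |k x| ≤ κ * x ^ (β - 1)) {x : ℝ} (hx : b < x) : 0 ≤ k x := by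
  have h1 : Filter.Tendsto (fun y : ℝ ↦ -(κ * y ^ (β - 1))) Filter.atTop (nhds (-(κ * 0))) := by
    have := tendsto_rpow_neg_atTop (y := 1 - β) (by linarith)
    rw [neg_sub] at this
    exact (this.const_mul κ).neg
  rw [mul_zero, neg_zero] at h1
  refine le_of_tendsto h1 ?_
  filter_upwards [Filter.eventually_ge_atTop x] with y hy
  have hy' : b < y := hx.trans_le hy
  exact (neg_le_of_abs_le (hκ y hy')).trans (hk hx hy' hy)

/-- Up to a null set, the superlevel sets of `k` on `(b, ∞)` are intervals `(b, t]`. -/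
lemma exists_superlevel_ae_eq_Ioc {ν : Measure ℝ} (hν : ∀ x, ν {x} = 0) (hβ : β < 1) (hb : 1 ≤ b)
    (hk : Antitone k) (hκ : ∀ x, b < x → k x ≤ κ * x ^ (β - 1)) {s : ℝ} (hs : 0 < s)
    (hsM : s ≤ κ * b ^ (β - 1)) :
    ∃ t, b ≤ t ∧
      Real.log (1 + t) ≤ Real.log (1 + b) + (1 - β)⁻¹ * Real.log (κ * b ^ (β - 1) / s) ∧
      {x | b < x ∧ s < k x} =ᵐ[ν] Set.Ioc b t := by
  have hb0 : 0 < b := by linarith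
  have hbp : 0 < b ^ (β - 1) := by positivity
  have hκ0 : 0 < κ := pos_of_mul_pos_left (hs.trans_le hsM) hbp.le
  set A := {x | b < x ∧ s < k x} with hA
  set H := Real.log (1 + b) + (1 - β)⁻¹ * Real.log (κ * b ^ (β - 1) / s) with hH
  have hβ' : 0 < 1 - β := by linarith
  -- From `s < κ x^{β-1}` comes `x ≤ b (κ b^{β-1}/s)^{1/(1-β)}`; passing to `log(1+x)` uses `(1+x)/x
  -- ≤ (1+b)/b` for `x > b`.
  have hbd : ∀ x ∈ A, x ≤ Real.exp H - 1 := by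
    rintro x ⟨hbx, hsx⟩
    have hx0 : 0 < x := hb0.trans hbx
    have h1 : Real.log s ≤ Real.log κ + (β - 1) * Real.log x := by
      rw [← Real.log_rpow hx0, ← Real.log_mul hκ0.ne' (by positivity)]
      exact Real.log_le_log hs (hsx.le.trans (hκ x hbx))
    have h2 : Real.log (κ * b ^ (β - 1) / s) = Real.log κ + (β - 1) * Real.log b - Real.log s := by
      rw [Real.log_div (by positivity) hs.ne', Real.log_mul hκ0.ne' (by positivity),
        Real.log_rpow hb0]
    have h3 : Real.log x - Real.log b ≤ (1 - β)⁻¹ * Real.log (κ * b ^ (β - 1) / s) := by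
      rw [inv_mul_eq_div, le_div_iff₀ hβ', h2]
      linarith
    have h4 : Real.log (1 + x) + Real.log b ≤ Real.log (1 + b) + Real.log x := by
      rw [← Real.log_mul (by positivity) (by positivity),
        ← Real.log_mul (by positivity) (by positivity)]
      exact Real.log_le_log (by positivity) (by linarith)
    have h5 : Real.log (1 + x) ≤ H := by linarith
    have := (Real.log_le_iff_le_exp (by linarith)).1 h5
    linarith
  rcases A.eq_empty_or_nonempty with hAe | ⟨x₀, hx₀⟩
  · refine ⟨b, le_rfl, le_add_of_nonneg_right ?_, ?_⟩
    · have : 0 ≤ Real.log (κ * b ^ (β - 1) / s) := Real.log_nonneg ((one_le_div hs).2 hsM)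
      positivity
    · rw [hAe, Set.Ioc_self]
      exact Filter.EventuallyEq.rfl
  have hba : BddAbove A := ⟨_, hbd⟩
  refine ⟨sSup A, hx₀.1.le.trans (le_csSup hba hx₀), ?_, ?_⟩
  · have h1 : sSup A ≤ Real.exp H - 1 := csSup_le ⟨x₀, hx₀⟩ hbd
    have h2 : x₀ ≤ sSup A := le_csSup hba hx₀
    have h3 := hx₀.1
    rw [Real.log_le_iff_le_exp (by linarith)]
    linarith
  -- Membership of the supremum is the only undecided point, and `ν` has no atoms.
  · have hne : ∀ᵐ x ∂ν, x ≠ sSup A := by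
      rw [ae_iff]
      simpa using hν (sSup A)
    filter_upwards [hne] with x hx
    refine propext ⟨fun h ↦ ⟨h.1, le_csSup hba h⟩, fun h ↦ ⟨h.1, ?_⟩⟩
    obtain ⟨y, hy, hxy⟩ := exists_lt_of_lt_csSup ⟨x₀, hx₀⟩ (lt_of_le_of_ne h.2 hx)
    exact hy.2.trans_le (hk hxy.le)

lemma integral_log_div_Ioc {M : ℝ} (hM : 0 ≤ M) (p q : ℝ) :
    IntegrableOn (fun s ↦ p + q * Real.log (M / s)) (Set.Ioc 0 M) ∧
      ∫ s in Set.Ioc 0 M, (p + q * Real.log (M / s)) = M * (p + q) := by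
  have heq : Set.EqOn (fun s ↦ p + q * Real.log (M / s))
      (fun s ↦ (p + q * Real.log M) - q * Real.log s) (Set.Ioc 0 M) := by
    intro s hs
    have : 0 < M := hs.1.trans_le hs.2
    simp only
    rw [Real.log_div this.ne' hs.1.ne']
    ring
  have hi : IntervalIntegrable (fun s ↦ (p + q * Real.log M) - q * Real.log s) volume 0 M :=
    intervalIntegrable_const.sub (intervalIntegral.intervalIntegrable_log'.const_mul q)
  refine ⟨((intervalIntegrable_iff_integrableOn_Ioc_of_le hM).1 hi).congr_fun heq.symm
    measurableSet_Ioc, ?_⟩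
  rw [setIntegral_congr_fun measurableSet_Ioc heq, ← intervalIntegral.integral_of_le hM,
    intervalIntegral.integral_sub intervalIntegrable_const
      (intervalIntegral.intervalIntegrable_log'.const_mul q), intervalIntegral.integral_const,
    intervalIntegral.integral_const_mul, integral_log]
  simp
  ring

end layerCake

section oneSided
variable {Ω : Type*} [MeasurableSpace Ω] {P : Measure Ω} [IsProbabilityMeasure P] {ξ η : Ω → ℝ}
  {β κ b C : ℝ} {k : ℝ → ℝ}

lemma measurableSet_superlevel (hk : Antitone k) (s : ℝ) :
    MeasurableSet {x | b < x ∧ s < k x} :=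
  (measurableSet_lt measurable_const measurable_id).inter
    (measurableSet_lt measurable_const hk.measurable)

/-- This is `k(x) = ∫_0^M 1_{s<k(x)} ds` for `0 ≤ k(x) ≤ M`, followed by Fubini. -/
lemma integral_indicator_mul_eq_layerCake {M : ℝ}
    (hk0 : ∀ x, b < x → 0 ≤ k x) (hkM : ∀ x, b < x → k x ≤ M) {Y : Ω → ℝ}
    (hint : Integrable (fun p : Ω × ℝ ↦ ξ p.1 * {x | b < x ∧ p.2 < k x}.indicator 1 (ξ p.1) * Y p.1)
      (P.prod (volume.restrict (Set.Ioc 0 M)))) :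
    Integrable (fun ω ↦ (Set.Ioi b).indicator (fun x ↦ x * k x) (ξ ω) * Y ω) P ∧
      ∫ ω, (Set.Ioi b).indicator (fun x ↦ x * k x) (ξ ω) * Y ω ∂P =
        ∫ s in Set.Ioc 0 M, ∫ ω, ξ ω * {x | b < x ∧ s < k x}.indicator 1 (ξ ω) * Y ω ∂P := by
  have key : ∀ ω, ∫ s in Set.Ioc 0 M, ξ ω * {x | b < x ∧ s < k x}.indicator 1 (ξ ω) * Y ω =
      (Set.Ioi b).indicator (fun x ↦ x * k x) (ξ ω) * Y ω := by
    intro ω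
    by_cases hb : b < ξ ω
    · have h1 : ∀ s : ℝ, ξ ω * {x | b < x ∧ s < k x}.indicator 1 (ξ ω) * Y ω =
          (Set.Iio (k (ξ ω))).indicator (fun _ ↦ ξ ω * Y ω) s := by
        intro s
        by_cases hs : s < k (ξ ω)
        · rw [Set.indicator_of_mem (show s ∈ Set.Iio _ from hs),
            Set.indicator_of_mem (show ξ ω ∈ {x | b < x ∧ s < k x} from ⟨hb, hs⟩)]
          simp
        · rw [Set.indicator_of_notMem (show s ∉ Set.Iio _ from hs),
            Set.indicator_of_notMem (show ξ ω ∉ {x | b < x ∧ s < k x} from fun h ↦ hs h.2)]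
          simp
      simp_rw [h1]
      rw [setIntegral_indicator measurableSet_Iio, setIntegral_const,
        Set.indicator_of_mem (show ξ ω ∈ Set.Ioi b from hb), smul_eq_mul]
      have h2 : volume.real (Set.Ioc 0 M ∩ Set.Iio (k (ξ ω))) = k (ξ ω) := by
        have h3 : Set.Ioo 0 (k (ξ ω)) ⊆ Set.Ioc 0 M ∩ Set.Iio (k (ξ ω)) := fun s hs ↦
          ⟨⟨hs.1, hs.2.le.trans (hkM _ hb)⟩, hs.2⟩
        have h4 : Set.Ioc 0 M ∩ Set.Iio (k (ξ ω)) ⊆ Set.Ioo 0 (k (ξ ω)) := fun s hs ↦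
          ⟨hs.1.1, hs.2⟩
        rw [h4.antisymm h3, Real.volume_real_Ioo_of_le (hk0 _ hb), sub_zero]
      rw [h2]
      ring
    · have h1 : ∀ s : ℝ, ξ ω * {x | b < x ∧ s < k x}.indicator 1 (ξ ω) * Y ω = 0 := by
        intro s
        rw [Set.indicator_of_notMem (fun h ↦ hb h.1)]
        simp
      simp_rw [h1]
      rw [Set.indicator_of_notMem (show ξ ω ∉ Set.Ioi b from hb)]
      simp
  refine ⟨hint.integral_prod_left.congr (ae_of_all _ fun ω ↦ key ω), ?_⟩
  rw [← integral_integral_swap hint]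
  exact integral_congr_ae (ae_of_all _ fun ω ↦ (key ω).symm)

/-- Layer-cake passage from truncations of `ξ` to `ξ k(ξ) 1_{ξ > b}` with `k` monotone. -/
lemma abs_cov_of_antitone_le (hξ : Integrable ξ P) (hη : AEMeasurable η P) {c : NNReal}
    (hc : P.map η ≤ c • volume) (hξ0 : ∀ x, P.map ξ {x} = 0) (hC : 0 ≤ C)
    (hβ : β < 1) (hb : 1 ≤ b) (hκ0 : 0 ≤ κ)
    (hcov : ∀ t, b ≤ t → ∀ L : ℝ → ℝ, Integrable L →
      |(∫ ω, ξ ω * (Set.Ioc b t).indicator 1 (ξ ω) * L (η ω) ∂P) -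
        (∫ ω, ξ ω * (Set.Ioc b t).indicator 1 (ξ ω) ∂P) * ∫ ω, L (η ω) ∂P| ≤
        C * Real.log (1 + t) * ∫ y, |L y|)
    (hk : AntitoneOn k (Set.Ioi b)) (hκ : ∀ x, b < x → |k x| ≤ κ * x ^ (β - 1))
    {L : ℝ → ℝ} (hL : Integrable L) :
    Integrable (fun ω ↦ (Set.Ioi b).indicator (fun x ↦ x * k x) (ξ ω)) P ∧
    Integrable (fun ω ↦ (Set.Ioi b).indicator (fun x ↦ x * k x) (ξ ω) * L (η ω)) P ∧
    |(∫ ω, (Set.Ioi b).indicator (fun x ↦ x * k x) (ξ ω) * L (η ω) ∂P) -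
      (∫ ω, (Set.Ioi b).indicator (fun x ↦ x * k x) (ξ ω) ∂P) * ∫ ω, L (η ω) ∂P| ≤
      C * (∫ y, |L y|) * (κ * b ^ (β - 1) * (Real.log (1 + b) + (1 - β)⁻¹)) := by
  have hξm := hξ.aemeasurable
  have hb0 : 0 < b := by linarith
  set M := κ * b ^ (β - 1) with hM
  have hM0 : 0 ≤ M := by positivity
  have hkM' : ∀ x, b < x → k x ≤ M := fun x hx ↦
    (le_of_abs_le (hκ x hx)).trans (mul_le_mul_of_nonneg_left
      (Real.rpow_le_rpow_of_nonpos hb0 hx.le (by linarith)) hκ0)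
  have hk0' : ∀ x, b < x → 0 ≤ k x := fun x hx ↦ nonneg_of_antitoneOn_of_abs_le_rpow hβ hk hκ hx
  -- A globally antitone extension makes the superlevel sets measurable, jointly in the level as
  -- well.
  obtain ⟨g, hg, hgk⟩ := hk.exists_antitone_extension
    ⟨0, by rintro _ ⟨x, hx, rfl⟩; exact hk0' x hx⟩ ⟨M, by rintro _ ⟨x, hx, rfl⟩; exact hkM' x hx⟩
  have hind : ∀ x, (Set.Ioi b).indicator (fun x ↦ x * k x) x =
      (Set.Ioi b).indicator (fun x ↦ x * g x) x := fun x ↦ by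
    by_cases hx : x ∈ Set.Ioi b
    · rw [Set.indicator_of_mem hx, Set.indicator_of_mem hx, hgk hx]
    · rw [Set.indicator_of_notMem hx, Set.indicator_of_notMem hx]
  simp_rw [hind]
  have hkM : ∀ x, b < x → g x ≤ M := fun x hx ↦ hgk hx ▸ hkM' x hx
  have hk0 : ∀ x, b < x → 0 ≤ g x := fun x hx ↦ hgk hx ▸ hk0' x hx
  have hgκ : ∀ x, b < x → g x ≤ κ * x ^ (β - 1) := fun x hx ↦
    hgk hx ▸ (le_of_abs_le (hκ x hx))
  set A : ℝ → Set ℝ := fun s ↦ {x | b < x ∧ s < g x} with hA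
  set H : ℝ → ℝ := fun s ↦ Real.log (1 + b) + (1 - β)⁻¹ * Real.log (M / s) with hH
  have hIL := integrable_comp_of_map_le hη hc hL
  have hcovA : ∀ s ∈ Set.Ioc 0 M, ∀ L : ℝ → ℝ, Integrable L →
      Integrable (fun ω ↦ ξ ω * (A s).indicator 1 (ξ ω) * L (η ω)) P ∧
      |(∫ ω, ξ ω * (A s).indicator 1 (ξ ω) * L (η ω) ∂P) -
        (∫ ω, ξ ω * (A s).indicator 1 (ξ ω) ∂P) * ∫ ω, L (η ω) ∂P| ≤
        C * H s * ∫ y, |L y| := by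
    intro s hs L hL
    obtain ⟨t, hbt, hlog, hae⟩ := exists_superlevel_ae_eq_Ioc hξ0 hβ hb hg hgκ hs.1 hs.2
    have hae' : ∀ᵐ ω ∂P, (A s).indicator (1 : ℝ → ℝ) (ξ ω) = (Set.Ioc b t).indicator 1 (ξ ω) := by
      filter_upwards [ae_of_ae_map hξm (indicator_ae_eq_of_ae_eq_set (f := (1 : ℝ → ℝ)) hae)]
        with ω hω using hω
    have e1 : ∀ᵐ ω ∂P, ξ ω * (Set.Ioc b t).indicator 1 (ξ ω) * L (η ω) =
        ξ ω * (A s).indicator 1 (ξ ω) * L (η ω) := by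
      filter_upwards [hae'] with ω hω
      rw [hω]
    have e2 : ∀ᵐ ω ∂P, ξ ω * (Set.Ioc b t).indicator 1 (ξ ω) =
        ξ ω * (A s).indicator 1 (ξ ω) := by
      filter_upwards [hae'] with ω hω
      rw [hω]
    constructor
    · refine Integrable.congr ?_ e1
      refine (integrable_comp_of_map_le hη hc hL).bdd_mul (c := t) ?_ (ae_of_all _ fun ω ↦ ?_)
      · exact (hξm.mul ((measurable_one.indicator measurableSet_Ioc).comp_aemeasurable
          hξm)).aestronglyMeasurable
      · by_cases hω : ξ ω ∈ Set.Ioc b t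
        · rw [Set.indicator_of_mem hω, Pi.one_apply, mul_one,
            Real.norm_of_nonneg (by linarith [hω.1])]
          exact hω.2
        · rw [Set.indicator_of_notMem hω, mul_zero, norm_zero]
          linarith
    · rw [← integral_congr_ae e1, ← integral_congr_ae e2]
      refine (hcov t hbt L hL).trans ?_
      have : 0 ≤ ∫ y, |L y| := integral_nonneg fun _ ↦ abs_nonneg _
      gcongr
  have hmeas : AEMeasurable (fun p : Ω × ℝ ↦ ξ p.1 * (A p.2).indicator 1 (ξ p.1))
      (P.prod (volume.restrict (Set.Ioc 0 M))) := by
    have h1 : AEMeasurable (fun p : Ω × ℝ ↦ ξ p.1) (P.prod (volume.restrict (Set.Ioc 0 M))) :=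
      hξm.comp_fst
    have h2 : MeasurableSet {q : ℝ × ℝ | b < q.1 ∧ q.2 < g q.1} :=
      (measurableSet_lt measurable_const measurable_fst).inter
        (measurableSet_lt measurable_snd (hg.measurable.comp measurable_fst))
    have h3 : Measurable ({q : ℝ × ℝ | b < q.1 ∧ q.2 < g q.1}.indicator (1 : ℝ × ℝ → ℝ)) :=
      measurable_one.indicator h2
    exact h1.mul (h3.comp_aemeasurable (h1.prodMk measurable_snd.aemeasurable))
  have hle1 : ∀ s x, ‖x * (A s).indicator (1 : ℝ → ℝ) x‖ ≤ |x| := fun s x ↦ by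
    by_cases hx : x ∈ A s
    · rw [Set.indicator_of_mem hx, Pi.one_apply, mul_one, Real.norm_eq_abs]
    · rw [Set.indicator_of_notMem hx, mul_zero, norm_zero]
      exact abs_nonneg _
  have hnn : ∀ s x, 0 ≤ x * (A s).indicator (1 : ℝ → ℝ) x := fun s x ↦ by
    by_cases hx : x ∈ A s
    · rw [Set.indicator_of_mem hx, Pi.one_apply, mul_one]
      linarith [hx.1]
    · rw [Set.indicator_of_notMem hx, mul_zero]
  have hXi : ∀ s, Integrable (fun ω ↦ ξ ω * (A s).indicator 1 (ξ ω)) P := fun s ↦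
    hξ.abs.mono' (hξm.mul ((measurable_one.indicator (measurableSet_superlevel hg s)).comp_aemeasurable
      hξm)).aestronglyMeasurable (ae_of_all _ fun ω ↦ hle1 s (ξ ω))
  have hHi := (integral_log_div_Ioc hM0 (Real.log (1 + b)) (1 - β)⁻¹)
  have hprod1 : Integrable (fun p : Ω × ℝ ↦ ξ p.1 * (A p.2).indicator 1 (ξ p.1) * (fun _ ↦ (1 : ℝ)) p.1)
      (P.prod (volume.restrict (Set.Ioc 0 M))) := by
    simp only [mul_one]
    exact (hξ.abs.comp_fst (volume.restrict (Set.Ioc 0 M))).mono' hmeas.aestronglyMeasurable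
      (ae_of_all _ fun p ↦ hle1 p.2 (ξ p.1))
  -- Integrability of `ξ L(η)` is not known. The covariance bound itself, applied to `|L|`, bounds
  -- the slice norms by `E|ξ| E|L(η)|` plus a multiple of `H s`, which is integrable in `s`.
  have hprodL : Integrable (fun p : Ω × ℝ ↦ ξ p.1 * (A p.2).indicator 1 (ξ p.1) * (fun ω ↦ L (η ω)) p.1)
      (P.prod (volume.restrict (Set.Ioc 0 M))) := by
    have hm : AEStronglyMeasurable
        (fun p : Ω × ℝ ↦ ξ p.1 * (A p.2).indicator 1 (ξ p.1) * (fun ω ↦ L (η ω)) p.1)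
        (P.prod (volume.restrict (Set.Ioc 0 M))) :=
      hmeas.aestronglyMeasurable.mul hIL.aestronglyMeasurable.comp_fst
    rw [integrable_prod_iff' hm]
    refine ⟨?_, ?_⟩
    · filter_upwards [self_mem_ae_restrict measurableSet_Ioc] with s hs
      exact (hcovA s hs L hL).1
    · refine (Integrable.add (hHi.1.const_mul (C * ∫ y, |L y|))
        (integrable_const ((∫ ω, |ξ ω| ∂P) * ∫ ω, |L (η ω)| ∂P))).mono'
        hm.norm.prod_swap.integral_prod_right' ?_
      filter_upwards [self_mem_ae_restrict measurableSet_Ioc] with s hs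
      rw [Real.norm_of_nonneg (integral_nonneg fun _ ↦ norm_nonneg _)]
      have h1 := (hcovA s hs (fun y ↦ |L y|) hL.abs).2
      simp only [abs_abs] at h1
      have h2 : ∫ ω, ‖ξ ω * (A s).indicator 1 (ξ ω) * L (η ω)‖ ∂P =
          ∫ ω, ξ ω * (A s).indicator 1 (ξ ω) * |L (η ω)| ∂P := by
        congr with ω
        rw [norm_mul, Real.norm_of_nonneg (hnn s _), Real.norm_eq_abs]
      rw [h2]
      have h3 : ∫ ω, ξ ω * (A s).indicator 1 (ξ ω) ∂P ≤ ∫ ω, |ξ ω| ∂P :=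
        integral_mono (hXi s) hξ.abs fun ω ↦ (le_abs_self _).trans (hle1 s (ξ ω))
      have h4 : 0 ≤ ∫ ω, |L (η ω)| ∂P := integral_nonneg fun _ ↦ abs_nonneg _
      have h5 := mul_le_mul_of_nonneg_right h3 h4
      have h6 := le_of_abs_le h1
      have h7 : C * (∫ y, |L y|) * H s = C * H s * ∫ y, |L y| := by ring
      show _ ≤ C * (∫ y, |L y|) * H s + _
      linarith
  obtain ⟨i1, e1⟩ := integral_indicator_mul_eq_layerCake (Y := fun _ ↦ (1 : ℝ)) hk0 hkM hprod1
  obtain ⟨i2, e2⟩ := integral_indicator_mul_eq_layerCake (Y := fun ω ↦ L (η ω)) hk0 hkM hprodL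
  simp only [mul_one] at i1 e1
  refine ⟨i1, i2, ?_⟩
  have j1 : Integrable (fun s ↦ ∫ ω, ξ ω * (A s).indicator 1 (ξ ω) ∂P)
      (volume.restrict (Set.Ioc 0 M)) := by
    simpa only [mul_one] using hprod1.integral_prod_right
  have j2 : Integrable (fun s ↦ ∫ ω, ξ ω * (A s).indicator 1 (ξ ω) * L (η ω) ∂P)
      (volume.restrict (Set.Ioc 0 M)) := hprodL.integral_prod_right
  rw [e1, e2, ← integral_mul_const, ← integral_sub j2 (j1.mul_const _), ← Real.norm_eq_abs,
    ← hHi.2, ← integral_const_mul]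
  refine norm_integral_le_of_norm_le (hHi.1.const_mul _) ?_
  filter_upwards [self_mem_ae_restrict measurableSet_Ioc] with s hs
  refine ((hcovA s hs L hL).2).trans_eq ?_
  ring

end oneSided

lemma exists_le_smul_volume_of_stable {ν : Measure ℝ} [IsProbabilityMeasure ν] {α a : ℝ}
    (hα : 0 < α) (ha : 0 < a) (h : ∀ t, charFun ν t = (Real.exp (-(|t| ^ α * a)) : ℝ)) :
    ∃ c : NNReal, ν ≤ c • volume := by
  obtain ⟨M, hM, hb⟩ := exists_rpow_mul_exp_neg_le hα ha le_rfl
  refine ⟨NNReal.pi * ⟨M, hM.le⟩, le_smul_volume_of_charFun fun t ↦ ?_⟩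
  have := hb t
  rw [Real.rpow_zero, one_mul, mul_comm] at this
  rwa [h t, Complex.norm_real, Real.norm_of_nonneg (Real.exp_pos _).le]

/-! ### Measurability and growth of the cutoff, and its split into half-lines -/

section cutoff
variable {K : ℝ → ℝ} {β κ b : ℝ}

lemma AssumptionK1.nonneg (h : AssumptionK1 K β κ b) : 0 ≤ κ := by
  have hx : b < |max b 0 + 1| := by
    rw [abs_of_nonneg (by positivity)]
    linarith [le_max_left b 0]
  have h1 := (abs_nonneg _).trans (h _ hx)
  have h2 : 0 < |max b 0 + 1| := abs_pos.2 (by positivity)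
  exact nonneg_of_mul_nonneg_left h1 (by positivity)

lemma AssumptionK1.abs_div_le (h : AssumptionK1 K β κ b) {x : ℝ} (hx : x ≠ 0) (hbx : b < |x|) :
    |K x / x| ≤ κ * |x| ^ (β - 1) := by
  have hx' : 0 < |x| := abs_pos.2 hx
  rw [abs_div, div_le_iff₀ hx', Real.rpow_sub_one hx'.ne', mul_assoc, div_mul_cancel₀ _ hx'.ne']
  exact h x hbx

/-- Measurability of `K` is not assumed; monotonicity of `K(x)/x` on each half-line supplies it. -/
lemma AssumptionK2.aemeasurable_cutoff (h : AssumptionK2 K b) (hb : 0 ≤ b) (ν : Measure ℝ) :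
    AEMeasurable (cutoff K b) ν := by
  have hset : {x : ℝ | b < |x|} = Set.Ioi b ∪ Set.Iio (-b) := by
    ext x
    simp only [Set.mem_ofPred_eq, Set.mem_union, Set.mem_Ioi, Set.mem_Iio, lt_abs]
    constructor <;> rintro (h | h) <;> first | exact Or.inl h | exact Or.inr (by linarith)
  have hrec : ∀ {s : Set ℝ}, MeasurableSet s → (∀ x ∈ s, x ≠ 0) →
      AEMeasurable (fun x ↦ K x / x) (ν.restrict s) → AEMeasurable K (ν.restrict s) := by
    intro s hs h0 hm
    refine (hm.mul aemeasurable_id).congr ?_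
    filter_upwards [self_mem_ae_restrict hs] with x hx
    exact div_mul_cancel₀ _ (h0 x hx)
  rw [cutoff, hset, aemeasurable_indicator_iff (measurableSet_Ioi.union measurableSet_Iio),
    aemeasurable_union_iff]
  refine ⟨hrec measurableSet_Ioi (fun x hx ↦ (hb.trans_lt hx).ne')
    (aemeasurable_restrict_of_antitoneOn measurableSet_Ioi h.1),
    hrec measurableSet_Iio (fun x hx ↦ (lt_of_lt_of_le hx (by linarith)).ne) ?_⟩
  rcases h.2 with h | h
  · exact aemeasurable_restrict_of_monotoneOn measurableSet_Iio h
  · exact aemeasurable_restrict_of_antitoneOn measurableSet_Iio h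

lemma AssumptionK1.abs_cutoff_le (h : AssumptionK1 K β κ b) (hb : 1 ≤ b) (hβ : β ≤ 1) (x : ℝ) :
    |cutoff K b x| ≤ κ * |x| := by
  by_cases hx : b < |x|
  · rw [cutoff, Set.indicator_of_mem (show x ∈ {x : ℝ | b < |x|} from hx)]
    refine (h x hx).trans (mul_le_mul_of_nonneg_left ?_ h.nonneg)
    exact (Real.rpow_le_rpow_of_exponent_le (hb.trans hx.le) hβ).trans_eq (Real.rpow_one _)
  · rw [cutoff, Set.indicator_of_notMem (show x ∉ {x : ℝ | b < |x|} from hx), abs_zero]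
    exact mul_nonneg h.nonneg (abs_nonneg x)

lemma integrable_cutoff_comp {Ω : Type*} [MeasurableSpace Ω] {P : Measure Ω} {ξ : Ω → ℝ}
    (hξ : Integrable ξ P) (h₁ : AssumptionK1 K β κ b) (h₂ : AssumptionK2 K b) (hb : 1 ≤ b)
    (hβ : β ≤ 1) : Integrable (fun ω ↦ cutoff K b (ξ ω)) P :=
  (hξ.abs.const_mul κ).mono'
    ((h₂.aemeasurable_cutoff (by linarith) _).comp_aemeasurable hξ.aemeasurable).aestronglyMeasurable
    (ae_of_all _ fun ω ↦ h₁.abs_cutoff_le hb hβ (ξ ω))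

/-- The cutoff splits into two one-sided pieces of the form `x k(x) 1_{x > b}` with `k` monotone. -/
lemma exists_cutoff_eq_add (h₁ : AssumptionK1 K β κ b) (h₂ : AssumptionK2 K b) (hb : 0 ≤ b) :
    ∃ (k : ℝ → ℝ) (e : ℝ), |e| = 1 ∧ AntitoneOn k (Set.Ioi b) ∧
      (∀ x, b < x → |k x| ≤ κ * x ^ (β - 1)) ∧
      ∀ x, cutoff K b x = (Set.Ioi b).indicator (fun x ↦ x * (K x / x)) x +
        e * (Set.Ioi b).indicator (fun x ↦ x * k x) (-x) := by
  -- The sign is chosen below so that `e K(-x)/(-x)` is antitone on `(b,∞)`: `1` in the monotone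
  -- case, `-1` in the antitone case.
  have hdec : ∀ e : ℝ, e * e = 1 → ∀ x, cutoff K b x =
      (Set.Ioi b).indicator (fun x ↦ x * (K x / x)) x +
        (-e) * (Set.Ioi b).indicator (fun x ↦ x * (e * (K (-x) / -x))) (-x) := by
    intro e he x
    by_cases hx : b < x
    · rw [cutoff, Set.indicator_of_mem (show x ∈ {x : ℝ | b < |x|} from hx.trans_le (le_abs_self x)),
        Set.indicator_of_mem (show x ∈ Set.Ioi b from hx),
        Set.indicator_of_notMem (show -x ∉ Set.Ioi b from not_lt.2 (by linarith : -x ≤ b)), mul_zero,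
        add_zero, mul_div_cancel₀ _ (hb.trans_lt hx).ne']
    by_cases hx' : b < -x
    · have hx0 : x ≠ 0 := by rintro rfl; linarith
      rw [cutoff, Set.indicator_of_mem (show x ∈ {x : ℝ | b < |x|} from hx'.trans_le (neg_le_abs x)),
        Set.indicator_of_notMem (show x ∉ Set.Ioi b from hx),
        Set.indicator_of_mem (show -x ∈ Set.Ioi b from hx'), neg_neg, zero_add]
      have : -e * (-x * (e * (K x / x))) = (e * e) * (x * (K x / x)) := by ring
      rw [this, he, one_mul, mul_div_cancel₀ _ hx0]
    · rw [cutoff, Set.indicator_of_notMem (show x ∉ {x : ℝ | b < |x|} from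
          not_lt.2 (abs_le'.2 ⟨not_lt.1 hx, not_lt.1 hx'⟩)),
        Set.indicator_of_notMem (show x ∉ Set.Ioi b from hx),
        Set.indicator_of_notMem (show -x ∉ Set.Ioi b from hx'), mul_zero, add_zero]
  have hbd : ∀ e : ℝ, |e| = 1 → ∀ x, b < x → |e * (K (-x) / -x)| ≤ κ * x ^ (β - 1) := by
    intro e he x hx
    have hx0 : 0 < x := hb.trans_lt hx
    have := h₁.abs_div_le (x := -x) (by linarith [hx0] : -x ≠ 0) (by rwa [abs_neg, abs_of_pos hx0])
    rw [abs_neg, abs_of_pos hx0] at this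
    rwa [abs_mul, he, one_mul]
  have hneg : ∀ x ∈ Set.Ioi b, -x ∈ Set.Iio (-b) := fun x hx ↦ neg_lt_neg (Set.mem_Ioi.1 hx)
  rcases h₂.2 with h | h
  · refine ⟨fun x ↦ 1 * (K (-x) / -x), -1, by simp, fun x hx y hy hxy ↦ ?_, hbd 1 (by simp),
      hdec 1 (by norm_num)⟩
    simp only [one_mul]
    exact h (hneg y hy) (hneg x hx) (neg_le_neg hxy)
  · refine ⟨fun x ↦ (-1) * (K (-x) / -x), - -1, by simp, fun x hx y hy hxy ↦ ?_, hbd (-1) (by simp),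
      hdec (-1) (by norm_num)⟩
    have := h (hneg y hy) (hneg x hx) (neg_le_neg hxy)
    simp only at this ⊢
    linarith

end cutoff

/-! ### Covariance identities -/

section covariance
variable {Ω : Type*} [MeasurableSpace Ω] {P : Measure Ω} [IsProbabilityMeasure P] {X Y : Ω → ℝ}

/-- Square integrability is avoided, since `L(η)` need not have a second moment. -/
lemma covariance_eq_sub_of_integrable (hX : Integrable X P) (hY : Integrable Y P)
    (hXY : Integrable (fun ω ↦ X ω * Y ω) P) :
    covariance X Y P = (∫ ω, X ω * Y ω ∂P) - (∫ ω, X ω ∂P) * ∫ ω, Y ω ∂P := by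
  have h1 : ∀ ω, (X ω - ∫ ω, X ω ∂P) * (Y ω - ∫ ω, Y ω ∂P) =
      (X ω * Y ω - X ω * ∫ ω, Y ω ∂P) - (∫ ω, X ω ∂P) * (Y ω - ∫ ω, Y ω ∂P) := fun ω ↦ by ring
  have h2 : Integrable (fun ω ↦ X ω * Y ω - X ω * ∫ ω, Y ω ∂P) P := hXY.sub (hX.mul_const _)
  have h3 : Integrable (fun ω ↦ Y ω - ∫ ω, Y ω ∂P) P := hY.sub (integrable_const _)
  rw [covariance]
  simp_rw [h1]
  rw [integral_sub h2 (h3.const_mul _), integral_sub hXY (hX.mul_const _), integral_mul_const,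
    integral_const_mul, integral_sub hY (integrable_const _)]
  simp

lemma covariance_eq_zero_of_ae_const (X : Ω → ℝ) {y : ℝ} (hY : ∀ᵐ ω ∂P, Y ω = y) :
    covariance X Y P = 0 := by
  have h1 : ∫ ω, Y ω ∂P = y := by
    rw [integral_congr_ae hY]
    simp
  rw [covariance, h1]
  refine integral_eq_zero_of_ae ?_
  filter_upwards [hY] with ω hω
  simp [hω]

end covariance

lemma norm_expCov_neg_left {Ω : Type*} [MeasurableSpace Ω] {P : Measure Ω} {ξ η : Ω → ℝ} (u v : ℝ) :
    ‖expCov P (fun ω ↦ -ξ ω) η u v‖ = ‖expCov P ξ η (-u) v‖ := by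
  rw [← norm_neg, expCov, expCov]
  congr 1
  simp only [mul_neg, neg_mul, Complex.ofReal_neg, integral_neg]
  ring

/-! ### Assembly: both half-lines, then the degenerate scales -/

section nondegenerate
variable {Ω : Type*} [MeasurableSpace Ω] {P : Measure Ω} [IsProbabilityMeasure P] {ξ η : Ω → ℝ}
  {β κ b B : ℝ} {K L : ℝ → ℝ} {c c' : NNReal}

lemma measure_singleton_eq_zero_of_le {ν : Measure ℝ} (hc : ν ≤ c • volume) (x : ℝ) :
    ν {x} = 0 := by
  refine le_antisymm ((hc {x}).trans ?_) zero_le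
  simp

lemma abs_cov_cutoff_le (hξ : Integrable ξ P) (hη : AEMeasurable η P)
    (hc : P.map η ≤ c • volume) (hc' : P.map ξ ≤ c' • volume) (hB : 0 ≤ B)
    (hR : ∀ u v, ‖expCov P ξ η u v‖ ≤ B / ((1 + u ^ 2) * (1 + v ^ 2)))
    (hβ : β < 1) (hb : 1 ≤ b) (h₁ : AssumptionK1 K β κ b) (h₂ : AssumptionK2 K b)
    (hL : Integrable L) :
    Integrable (fun ω ↦ cutoff K b (ξ ω) * L (η ω)) P ∧
    |covariance (fun ω ↦ cutoff K b (ξ ω)) (fun ω ↦ L (η ω)) P| ≤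
      2 * (9 * Real.pi * B * (∫ y, |L y|) *
        (κ * b ^ (β - 1) * (Real.log (1 + b) + (1 - β)⁻¹))) := by
  have hb0 : 0 ≤ b := by linarith
  have hC : 0 ≤ 9 * Real.pi * B := by have := Real.pi_pos; positivity
  obtain ⟨k, e, he, hk, hkb, hdec⟩ := exists_cutoff_eq_add h₁ h₂ hb0
  obtain ⟨i1, i2, i3⟩ := abs_cov_of_antitone_le hξ hη hc (measure_singleton_eq_zero_of_le hc') hC hβ
    hb h₁.nonneg (fun t ht L hL ↦ abs_cov_indicator_le hB hξ hη hc hR hb ht hL) h₂.1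
    (fun x hx ↦ by
      have hx0 : 0 < x := hb0.trans_lt hx
      simpa only [abs_of_pos hx0] using h₁.abs_div_le hx0.ne' (by rwa [abs_of_pos hx0])) hL
  have hξ0 : ∀ x, P.map (fun ω ↦ -ξ ω) {x} = 0 := fun x ↦ by
    have h1 : P.map (fun ω ↦ -ξ ω) = (P.map ξ).map (fun x ↦ -x) :=
      (AEMeasurable.map_map_of_aemeasurable (by fun_prop) hξ.aemeasurable).symm
    rw [h1, Measure.map_apply (by fun_prop) (measurableSet_singleton x)]
    have h2 : (fun x : ℝ ↦ -x) ⁻¹' {x} = {-x} := by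
      ext y
      simp
    rw [h2]
    exact measure_singleton_eq_zero_of_le hc' _
  have hR' : ∀ u v, ‖expCov P (fun ω ↦ -ξ ω) η u v‖ ≤ B / ((1 + u ^ 2) * (1 + v ^ 2)) :=
    fun u v ↦ by
      rw [norm_expCov_neg_left]
      simpa only [neg_sq] using hR (-u) v
  obtain ⟨j1, j2, j3⟩ := abs_cov_of_antitone_le hξ.fun_neg hη hc hξ0 hC hβ
    hb h₁.nonneg (fun t ht L hL ↦ abs_cov_indicator_le hB hξ.fun_neg hη hc hR' hb ht hL) hk hkb hL
  have hIL := integrable_comp_of_map_le hη hc hL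
  have hprod : ∀ ω, cutoff K b (ξ ω) * L (η ω) =
      (Set.Ioi b).indicator (fun x ↦ x * (K x / x)) (ξ ω) * L (η ω) +
        e * ((Set.Ioi b).indicator (fun x ↦ x * k x) (-ξ ω) * L (η ω)) := fun ω ↦ by
    rw [hdec]; ring
  have hI : Integrable (fun ω ↦ cutoff K b (ξ ω) * L (η ω)) P := by
    simp_rw [hprod]
    exact i2.add (j2.const_mul e)
  refine ⟨hI, ?_⟩
  rw [covariance_eq_sub_of_integrable (integrable_cutoff_comp hξ h₁ h₂ hb hβ.le) hIL hI]
  simp_rw [hprod, hdec]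
  rw [integral_add i2 (j2.const_mul e), integral_add i1 (j1.const_mul e), integral_const_mul,
    integral_const_mul]
  have hsplit : ∀ p q r s t : ℝ, p + e * q - (r + e * s) * t = (p - r * t) + e * (q - s * t) :=
    fun p q r s t ↦ by ring
  rw [hsplit, two_mul]
  refine (abs_add_le _ _).trans (add_le_add i3 ?_)
  rw [abs_mul, he, one_mul]
  exact j3

end nondegenerate

theorem theorem2p3 (α β ε₁ ε₂ κ σξ ση : ℝ) (hα₁ : 1 < α) (hα₂ : α < 2)
    (hβ₀ : 0 < β) (hβ₁ : β < α / 2) (hε₁ : 0 < ε₁) (hε₂ : 0 < ε₂) :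
    ∃ C : ℝ, 0 < C ∧
      ∀ {Ω S : Type*} [MeasurableSpace Ω] [MeasurableSpace S]
        (P : Measure Ω) [IsProbabilityMeasure P] (μ : Measure S)
        (ξ η : Ω → ℝ) (f g : S → ℝ),
        IsStablePair α P ξ η μ f g →
        alphaNorm α μ f = σξ →
        alphaNorm α μ g = ση →
        AssumptionA1 α μ f g ε₁ →
        AssumptionA2 α μ f g ε₂ →
        ∀ (b : ℝ) (K L : ℝ → ℝ), 1 ≤ b →
          AssumptionK1 K β κ b →
          AssumptionK2 K b →
          Integrable L volume →
          Integrable (fun ω => cutoff K b (ξ ω)) P ∧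
          Integrable (fun ω => L (η ω)) P ∧
          Integrable (fun ω => cutoff K b (ξ ω) * L (η ω)) P ∧
          |covariance (fun ω => cutoff K b (ξ ω)) (fun ω => L (η ω)) P| ≤
            C * b ^ (β - 1) * Real.log (b + 1) * (∫ y, |L y|) *
              (depOneStar α μ g f + depTwo α μ g f) := by
  have hα : 0 < α := by linarith
  have hβ : β < 1 := by linarith
  have hβ' : 0 < 1 - β := by linarith
  -- `M` must be chosen before `f` and `g`; if a scale is not positive, a dummy value suffices
  -- because no majorant will be needed.
  obtain ⟨M, hM, hmaj⟩ : ∃ M : ℝ, 0 < M ∧ (0 < σξ → 0 < ση → ∀ D₁ D₂ u v : ℝ, 0 ≤ D₁ → 0 ≤ D₂ →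
      (α * (2 * |v| ^ (α - 1) * D₁) +
        α * (|u| ^ (α - 1) * σξ ^ α) * (5 * (|u| ^ (α / 2) * |v| ^ (α / 2)) * D₂)) *
        Real.exp (-(min ε₂ 1 * (|u| ^ α * σξ ^ α + |v| ^ α * ση ^ α))) ≤
      M * (D₁ + D₂) / ((1 + u ^ 2) * (1 + v ^ 2))) := by
    by_cases h : 0 < σξ ∧ 0 < ση
    · obtain ⟨M, hM, hmaj⟩ := exists_expCov_majorant hα₁ (lt_min hε₂ one_pos)
        (Real.rpow_pos_of_pos h.1 α) (Real.rpow_pos_of_pos h.2 α)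
      exact ⟨M, hM, fun _ _ ↦ hmaj⟩
    · exact ⟨1, one_pos, fun h1 h2 ↦ absurd ⟨h1, h2⟩ h⟩
  have hπ := Real.pi_pos
  -- Two half-lines at `9π` each give 18; the last factor absorbs `(1-β)⁻¹` through `log(b+1) ≥
  -- 1/2`. The added 1 keeps the constant positive when `κ = 0`, and `|κ|` stands in until `K` is
  -- given and forces `κ ≥ 0`.
  refine ⟨18 * Real.pi * M * |κ| * (1 + 2 * (1 - β)⁻¹) + 1, by positivity, ?_⟩
  intro Ω S _ _ P _ μ ξ η f g h hf hg _ hA b K L hb h₁ h₂ hL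
  have hσξ : ∫ s, |f s| ^ α ∂μ = σξ ^ α := by rw [← hf, alphaNorm_rpow hα]
  have hση : ∫ s, |g s| ^ α ∂μ = ση ^ α := by rw [← hg, alphaNorm_rpow hα]
  have hξ := h.integrable_fst hα₁
  have hη := h.aemeasurable_snd
  have := Measure.isProbabilityMeasure_map (μ := P) h.aemeasurable_fst
  have := Measure.isProbabilityMeasure_map (μ := P) h.aemeasurable_snd
  have hφξ := h.charFun_map_fst hα
  have hφη := h.charFun_map_snd hα
  rw [hσξ] at hφξ
  rw [hση] at hφη
  have hcut := integrable_cutoff_comp hξ h₁ h₂ hb hβ.le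
  have hD₁ : 0 ≤ depOneStar α μ g f := depOneStar_nonneg
  have hD₂ : 0 ≤ depTwo α μ g f := depTwo_nonneg
  have hL0 : 0 ≤ ∫ y, |L y| := integral_nonneg fun _ ↦ abs_nonneg _
  have hb0 : 0 < b := by linarith
  have hlog : 1 / 2 ≤ Real.log (b + 1) := by
    have := Real.log_le_log (by norm_num) (show (2 : ℝ) ≤ b + 1 by linarith)
    linarith [Real.log_two_gt_d9]
  have hσξ0 : 0 ≤ σξ := hf ▸ Real.rpow_nonneg (integral_nonneg fun s ↦ by positivity) _
  have hση0 : 0 ≤ ση := hg ▸ Real.rpow_nonneg (integral_nonneg fun s ↦ by positivity) _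
  -- At scale zero `η = 0` almost surely and `L(η)` is the constant `L 0`. There is no density to
  -- use, but the covariance vanishes.
  rcases hση0.eq_or_lt with hση0 | hση0
  · have hη0 : ∀ᵐ ω ∂P, L (η ω) = L 0 := by
      rw [← hση0, Real.zero_rpow hα.ne'] at hφη
      filter_upwards [ae_of_ae_map hη (ae_eq_zero_of_charFun hα.le hφη)] with ω hω
      rw [hω]
    refine ⟨hcut, (integrable_const (L 0)).congr (hη0.mono fun ω hω ↦ hω.symm),
      (hcut.mul_const (L 0)).congr (hη0.mono fun ω hω ↦ by simp only [hω]), ?_⟩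
    rw [covariance_eq_zero_of_ae_const _ hη0, abs_zero]
    positivity
  obtain ⟨c, hc⟩ := exists_le_smul_volume_of_stable hα (Real.rpow_pos_of_pos hση0 α) hφη
  have hIL := integrable_comp_of_map_le hη hc hL
  rcases hσξ0.eq_or_lt with hσξ0 | hσξ0
  · have hξ0 : ∀ᵐ ω ∂P, cutoff K b (ξ ω) = 0 := by
      rw [← hσξ0, Real.zero_rpow hα.ne'] at hφξ
      filter_upwards [ae_of_ae_map hξ.aemeasurable (ae_eq_zero_of_charFun hα.le hφξ)] with ω hω
      rw [hω, cutoff, Set.indicator_of_notMem]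
      simpa using hb0.le
    refine ⟨hcut, hIL, (integrable_zero _ _ _).congr (hξ0.mono fun ω hω ↦ by simp [hω]), ?_⟩
    rw [covariance_comm, covariance_eq_zero_of_ae_const _ hξ0, abs_zero]
    positivity
  obtain ⟨c', hc'⟩ := exists_le_smul_volume_of_stable hα (Real.rpow_pos_of_pos hσξ0 α) hφξ
  have hR : ∀ u v, ‖expCov P ξ η u v‖ ≤
      M * (depOneStar α μ g f + depTwo α μ g f) / ((1 + u ^ 2) * (1 + v ^ 2)) := fun u v ↦ by
    have := h.norm_expCov_le hα₁ hα₂ hA u v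
    rw [hσξ, hση] at this
    exact this.trans (hmaj hσξ0 hση0 _ _ u v hD₁ hD₂)
  obtain ⟨hI, hcov⟩ := abs_cov_cutoff_le hξ hη hc hc' (by positivity) hR hβ hb h₁ h₂ hL
  refine ⟨hcut, hIL, hI, hcov.trans ?_⟩
  have hκ := h₁.nonneg
  rw [abs_of_nonneg hκ, add_comm 1 b]
  set D := depOneStar α μ g f + depTwo α μ g f
  have hD : 0 ≤ D := add_nonneg hD₁ hD₂
  have h3 : Real.log (b + 1) + (1 - β)⁻¹ ≤ (1 + 2 * (1 - β)⁻¹) * Real.log (b + 1) := by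
    have := mul_le_mul_of_nonneg_left hlog (inv_nonneg.2 hβ'.le)
    linarith
  calc _ = 18 * Real.pi * M * κ * (b ^ (β - 1) * (∫ y, |L y|) * D) *
          (Real.log (b + 1) + (1 - β)⁻¹) := by ring
    _ ≤ 18 * Real.pi * M * κ * (b ^ (β - 1) * (∫ y, |L y|) * D) *
          ((1 + 2 * (1 - β)⁻¹) * Real.log (b + 1)) := by gcongr
    _ ≤ 18 * Real.pi * M * κ * (b ^ (β - 1) * (∫ y, |L y|) * D) *
          ((1 + 2 * (1 - β)⁻¹) * Real.log (b + 1)) +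
        b ^ (β - 1) * (∫ y, |L y|) * D * Real.log (b + 1) := le_add_of_nonneg_right (by positivity)
    _ = _ := by ring
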